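/- Let $N\in\mathbb N$, $T>0$ and $1<\alpha\le 2$. All functions are real-valued and identified up to equality almost everywhere on $(0,T)$. **Spaces.** $H^\ell(0,T)$, $\ell\in\mathbb N_0$, is the usual Sobolev space (with $H^0=L^2$). For $0<\theta<1$, $H^\theta(0,T)$ is the space with finite norm $$\|f\|_{H^\theta}^2=\|f\|_{L^2}^2+\int_0^T\!\!\int_0^T\frac{|f(t)-f(s)|^2}{|t-s|^{1+2\theta}}\,dt\,ds .$$ For $\ell\ge1$ and $0<\theta<1$, $H^{\ell+\theta}(0,T)=\{f\in H^\ell(0,T):\ f^{(\ell)}\in H^\theta(0,T)\}$ with $\|f\|_{H^{\ell+\theta}}^2=\|f\|_{H^\ell}^2+\|f^{(\ell)}\|_{H^\theta}^2$. For $0\le\theta<1$, let $H_\theta(0,T)$ be $H^\theta(0,T)$ if $\theta<\frac12$; $\{f\in H^{1/2}(0,T):\int_0^T t^{-1}|f(t)|^2dt<\infty\}$ if $\theta=\frac12$; and $\{f\in H^\theta(0,T): f(0)=0\}$ if $\theta>\frac12$. Its norm is that of $H^\theta(0,T)$, except that $\|f\|_{H_{1/2}}^2=\|f\|_{H^{1/2}}^2+\int_0^T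 t^{-1}|f(t)|^2dt$. For $\ell\ge1$ and $0\le\theta<1$, $$H_{\ell+\theta}(0,T)=\{f\in H^\ell(0,T):\ f^{(k)}(0)=0\ (0\le k\le \ell-1),\ f^{(\ell)}\in H_\theta(0,T)\},\qquad \|f\|_{H_{\ell+\theta}}^2=\|f\|_{H^\ell}^2+\|f^{(\ell)}\|_{H_\theta}^2 .$$ Norms on $N$-fold products are the $\ell^2$-combinations of the component norms, and $\|P\|_{(L^\infty)^{N\times N}}$ is the maximum of the $L^\infty$-norms of the entries. **Fractional derivative.** Let $J^\alpha w(t)=\frac1{\Gamma(\alpha)}\int_0^t(t-s)^{\alpha-1}w(s)\,ds$ for $w\in L^2(0,T)$. The fractional derivative is $\partial_t^\alpha=(J^\alpha)^{-1}:H_\alpha(0,T)\to L^2(0,T)$; that is, for $f\in H_\alpha(0,T)$ and $w\in L^2(0,T)$, $\partial_t^\alpha f=w$ means $J^\alpha w=f$. It acts on vector-valued functions componentwise. **Theorem.** For all $a_0,a_1\in\mathbb R^N$, $F\in (L^2(0,T))^N$ and $P\in (L^\infty(0,T))^{N\times N}$, there is a unique $u:(0,T)\to\mathbb R^N$ (up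 to equality almost everywhere) such that $$u-a_0-ta_1\in (H_\alpha(0,T))^N,\qquad \partial_t^\alpha(u-a_0-ta_1)=P(t)u(t)+F(t),\quad 0<t<T .$$ Moreover $u\in (H^\alpha(0,T))^N$ and $$\|u-a_0-ta_1\|_{(H_\alpha(0,T))^N}+\|u\|_{(H^\alpha(0,T))^N}\le C\left(|a_0|+|a_1|+\|F\|_{(L^2(0,T))^N}\right),$$ where $C>0$ depends only on $\|P\|_{(L^\infty(0,T))^{N\times N}}$, $N$, $T$ and $\alpha$. -/

import Mathlib

open MeasureTheory Set
open scoped ENNReal ContDiff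

noncomputable section

namespace FracODE

/-- Lebesgue measure on the time interval `(0,T)`. Functions on `(0,T)` are represented by
functions on `ℝ`, up to equality almost everywhere for this measure. -/
def timeMeasure (T : ℝ) : Measure ℝ := volume.restrict (Ioo 0 T)

/-- `g` is the weak derivative of `f` on `(0,T)`: both are locally integrable and
`∫ f φ' = - ∫ g φ` for all test functions `φ ∈ C_c^∞(0,T)`. -/
def HasWeakDeriv (T : ℝ) (f g : ℝ → ℝ) : Prop :=
  LocallyIntegrableOn f (Ioo 0 T) ∧ LocallyIntegrableOn g (Ioo 0 T) ∧
  ∀ φ : ℝ → ℝ, ContDiff ℝ ∞ φ → HasCompactSupport φ → tsupport φ ⊆ Ioo 0 T →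
    ∫ t in Ioo 0 T, f t * deriv φ t = - ∫ t in Ioo 0 T, g t * φ t

open Classical in
/-- The weak derivative (a representative of it), `0` if there is none. -/
def weakDeriv (T : ℝ) (f : ℝ → ℝ) : ℝ → ℝ :=
  if h : ∃ g, HasWeakDeriv T f g then h.choose else 0

/-- The weak derivative of order `k`. -/
def iterWeakDeriv (T : ℝ) (k : ℕ) (f : ℝ → ℝ) : ℝ → ℝ := (weakDeriv T)^[k] f

/-- The Sobolev space `H^ℓ(0,T)` of integer order `ℓ`. -/
def MemHNat (T : ℝ) (l : ℕ) (f : ℝ → ℝ) : Prop :=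
  (∀ k < l, HasWeakDeriv T (iterWeakDeriv T k f) (iterWeakDeriv T (k + 1) f)) ∧
  ∀ k ≤ l, MemLp (iterWeakDeriv T k f) 2 (timeMeasure T)

/-- The square of the norm of `H^ℓ(0,T)`. -/
def hNatNormSq (T : ℝ) (l : ℕ) (f : ℝ → ℝ) : ℝ≥0∞ :=
  ∑ k ∈ Finset.range (l + 1), eLpNorm (iterWeakDeriv T k f) 2 (timeMeasure T) ^ 2

/-- The square of the Slobodeckij seminorm,
`∫_0^T ∫_0^T |f(t) - f(s)|² / |t - s|^(1+2θ) ds dt`. -/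
def slobodeckijSq (T θ : ℝ) (f : ℝ → ℝ) : ℝ≥0∞ :=
  ∫⁻ t in Ioo 0 T, ∫⁻ s in Ioo 0 T,
    ‖f t - f s‖ₑ ^ 2 / ENNReal.ofReal (|t - s| ^ (1 + 2 * θ))

/-- The space `H^θ(0,T)` for `0 ≤ θ < 1`, with `H^0 = L²`. -/
def MemHFrac (T θ : ℝ) (f : ℝ → ℝ) : Prop :=
  MemLp f 2 (timeMeasure T) ∧ (θ ≠ 0 → slobodeckijSq T θ f < ⊤)

open Classical in
/-- The square of the norm of `H^θ(0,T)` for `0 ≤ θ < 1`. -/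
def hFracNormSq (T θ : ℝ) (f : ℝ → ℝ) : ℝ≥0∞ :=
  eLpNorm f 2 (timeMeasure T) ^ 2 + if θ = 0 then 0 else slobodeckijSq T θ f

/-- The fractional Sobolev space `H^γ(0,T)`, `γ ≥ 0`: `f ∈ H^ℓ` and `d^ℓ f / dt^ℓ ∈ H^θ`
where `γ = ℓ + θ`, `ℓ = ⌊γ⌋`, `0 ≤ θ < 1`. -/
def MemH (T γ : ℝ) (f : ℝ → ℝ) : Prop :=
  MemHNat T ⌊γ⌋₊ f ∧ MemHFrac T (γ - ⌊γ⌋₊) (iterWeakDeriv T ⌊γ⌋₊ f)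

open Classical in
/-- The norm of `H^γ(0,T)`. -/
def hNorm (T γ : ℝ) (f : ℝ → ℝ) : ℝ≥0∞ :=
  (if γ = ⌊γ⌋₊ then hNatNormSq T ⌊γ⌋₊ f
    else if ⌊γ⌋₊ = 0 then hFracNormSq T γ f
    else hNatNormSq T ⌊γ⌋₊ f + hFracNormSq T (γ - ⌊γ⌋₊) (iterWeakDeriv T ⌊γ⌋₊ f))
      ^ (1 / 2 : ℝ)

/-- `f(0) = 0`, for a function given up to null sets of `(0,T)`: the representative of `f` that is
continuous on `[0,T]` exists and vanishes at `0`. -/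
def VanishesAtZero (T : ℝ) (f : ℝ → ℝ) : Prop :=
  ∃ g : ℝ → ℝ, ContinuousOn g (Icc 0 T) ∧ f =ᵐ[timeMeasure T] g ∧ g 0 = 0

/-- The weighted integral `∫_0^T t⁻¹ |f(t)|² dt`. -/
def weightedSq (T : ℝ) (f : ℝ → ℝ) : ℝ≥0∞ :=
  ∫⁻ t in Ioo 0 T, ‖f t‖ₑ ^ 2 / ENNReal.ofReal t

/-- The subspace `H_θ(0,T)` of `H^θ(0,T)` for `0 ≤ θ < 1`: all of `H^θ` if `θ < 1/2`, with
`∫_0^T t⁻¹ |f|² dt < ∞` if `θ = 1/2`, with `f(0) = 0` if `θ > 1/2`. -/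
def MemHSubFrac (T θ : ℝ) (f : ℝ → ℝ) : Prop :=
  MemHFrac T θ f ∧ (θ = 1 / 2 → weightedSq T f < ⊤) ∧ (1 / 2 < θ → VanishesAtZero T f)

open Classical in
/-- The square of the norm of `H_θ(0,T)` for `0 ≤ θ < 1`. -/
def hSubFracNormSq (T θ : ℝ) (f : ℝ → ℝ) : ℝ≥0∞ :=
  hFracNormSq T θ f + if θ = 1 / 2 then weightedSq T f else 0

/-- The space `H_γ(0,T)`, `γ ≥ 0`: with `γ = ℓ + θ`, `ℓ = ⌊γ⌋`, these are the `f ∈ H^ℓ` whose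
derivatives of orders `0, …, ℓ-1` vanish at `0` and whose derivative of order `ℓ` is in `H_θ`. -/
def MemHSub (T γ : ℝ) (f : ℝ → ℝ) : Prop :=
  MemHNat T ⌊γ⌋₊ f ∧ (∀ k < ⌊γ⌋₊, VanishesAtZero T (iterWeakDeriv T k f)) ∧
  MemHSubFrac T (γ - ⌊γ⌋₊) (iterWeakDeriv T ⌊γ⌋₊ f)

open Classical in
/-- The norm of `H_γ(0,T)`. -/
def hSubNorm (T γ : ℝ) (f : ℝ → ℝ) : ℝ≥0∞ :=
  (if ⌊γ⌋₊ = 0 then hSubFracNormSq T γ f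
    else hNatNormSq T ⌊γ⌋₊ f + hSubFracNormSq T (γ - ⌊γ⌋₊) (iterWeakDeriv T ⌊γ⌋₊ f))
      ^ (1 / 2 : ℝ)

/-- The Riemann-Liouville fractional integral `J^γ f` of order `γ > 0`. -/
def fracIntegral (γ : ℝ) (f : ℝ → ℝ) (t : ℝ) : ℝ :=
  ∫ s in (0 : ℝ)..t, (t - s) ^ (γ - 1) / Real.Gamma γ * f s

/-- `∂_t^γ f = w`, where `∂_t^γ : H_γ(0,T) → L²(0,T)` is the inverse of `J^γ`. -/
def HasFracDeriv (T γ : ℝ) (f w : ℝ → ℝ) : Prop :=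
  MemHSub T γ f ∧ MemLp w 2 (timeMeasure T) ∧ fracIntegral γ w =ᵐ[timeMeasure T] f

/-- The norm of `(H^γ(0,T))^N`. -/
def hNormVec (T γ : ℝ) {N : ℕ} (u : ℝ → EuclideanSpace ℝ (Fin N)) : ℝ≥0∞ :=
  (∑ i, hNorm T γ (fun t => u t i) ^ 2) ^ (1 / 2 : ℝ)

/-- The norm of `(H_γ(0,T))^N`. -/
def hSubNormVec (T γ : ℝ) {N : ℕ} (u : ℝ → EuclideanSpace ℝ (Fin N)) : ℝ≥0∞ :=
  (∑ i, hSubNorm T γ (fun t => u t i) ^ 2) ^ (1 / 2 : ℝ)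

/-- The norm of `P` in `(L^∞(0,T))^{N × N}`: the maximum of the norms of its entries. -/
def linftyNorm (T : ℝ) {N : ℕ} (P : ℝ → Matrix (Fin N) (Fin N) ℝ) : ℝ :=
  (⨆ i, ⨆ j, eLpNorm (fun t => P t i j) ∞ (timeMeasure T)).toReal

/-- `u` solves `∂_t^α (u - a₀ - t a₁) = P(t) u(t) + F(t)` on `(0,T)` with
`u - a₀ - t a₁ ∈ (H_α(0,T))^N`. -/
def IsSolution (T α : ℝ) {N : ℕ} (a₀ a₁ : EuclideanSpace ℝ (Fin N))
    (P : ℝ → Matrix (Fin N) (Fin N) ℝ) (F u : ℝ → EuclideanSpace ℝ (Fin N)) : Prop :=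
  ∀ i, MemHSub T α (fun t => (u t - a₀ - t • a₁) i) ∧
    HasFracDeriv T α (fun t => (u t - a₀ - t • a₁) i)
      (fun t => (P t).mulVec (u t).ofLp i + F t i)

end FracODE

end

/-!
Integrating, the initial value problem is equivalent to the Volterra equation
`u = a₀ + t a₁ + J^α F + J^α (P u)` for continuous functions on `[0,T]`. Since `α > 1`, the kernel
of `J^α` is bounded by `T^{α-1}/Γ(α)`, so for large `λ`, depending only on `T`, `α`, `N` and the
`L^∞` bound of `P`, the map `u ↦ J^α (P u)` halves the supremum norm with weight `e^{-λt}`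
(`abs_fracIntegral_mulVec_le`). This gives existence (`exists_volterra`), uniqueness
(`eqOn_of_volterra`) and a bound of `sup |u|` by the data (`abs_le_of_volterra`), hence a bound of
the right-hand side `w = P u + F` in `L²`.

What remains is that `J^α : L²(0,T) → H_α(0,T)` is bounded (`exists_memHSub_and_hSubNorm_le`).
With `θ = α - 1`, the semigroup property gives `(J^α w)' = J^θ w`, and for `α = 2` also
`(J^1 w)' = w`. For `0 < θ < 1` the sharp estimate of `J^θ w` in `H^θ` is obtained on the Fourier
side. On `(0,T)`, `J^θ w` is the convolution of `w`, extended by zero, with the kernel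
`t^{θ-1}/Γ(θ)` cut off to `(0,T)`. This kernel decreases on `(0,∞)`, so comparing it with its
translate by half a period bounds its Fourier transform by `|ξ|^{-θ}/Γ(θ+1)`
(`norm_fourier_le_of_antitoneOn`). By Plancherel's theorem for the differences `f(t+h) - f(t)`, the
Gagliardo integral over the whole plane is the integral of `|ξ|^{2θ} |f̂(ξ)|²` up to a constant, and
so is bounded by `‖w‖²` (`lintegral_gagliardo_le`). The remaining conditions at `t = 0` come from
the same extension, which vanishes for `t < 0`: for `θ = 1/2` the weighted integral
`∫ t⁻¹ |f(t)|² dt` is the part of the Gagliardo integral over `t > 0 > s`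
(`weightedSq_fracIntegral_half_le`), and for `θ > 1/2` the Fourier transform of `f` is integrable,
so that `f` is continuous on the line (`vanishesAtZero_fracIntegral_of_half_lt`).
-/

open MeasureTheory Set
open scoped ENNReal ContDiff

namespace FracODE

/-! ### Weak derivatives -/

lemma setIntegral_Ioo_eq_intervalIntegral {T : ℝ} (hT : 0 < T) (f : ℝ → ℝ) :
    ∫ t in Ioo 0 T, f t = ∫ t in (0 : ℝ)..T, f t := by
  rw [intervalIntegral.integral_of_le hT.le, integral_Ioc_eq_integral_Ioo]

lemma HasWeakDeriv.ae_unique {T : ℝ} {f g g' : ℝ → ℝ} (h : HasWeakDeriv T f g)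
    (h' : HasWeakDeriv T f g') : g =ᵐ[timeMeasure T] g' := by
  obtain ⟨-, hg, hi⟩ := h
  obtain ⟨-, hg', hi'⟩ := h'
  have key := isOpen_Ioo.ae_eq_zero_of_integral_contDiff_smul_eq_zero (μ := volume)
    (hg.sub hg') (U := Ioo 0 T) (fun φ hφ hc hs => ?_)
  · refine (ae_restrict_iff' measurableSet_Ioo).2 ?_
    filter_upwards [key] with x hx hxm
    exact sub_eq_zero.1 (hx hxm)
  have hint : ∀ k : ℝ → ℝ, LocallyIntegrableOn k (Ioo 0 T) →
      IntegrableOn (fun x => k x * φ x) (tsupport φ) := fun k hk =>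
    (hk.integrableOn_compact_subset hs hc).mul_continuousOn hφ.continuous.continuousOn hc
  have hint' : ∀ k : ℝ → ℝ, LocallyIntegrableOn k (Ioo 0 T) →
      IntegrableOn (fun x => k x * φ x) (Ioo 0 T) := fun k hk => by
    refine (integrableOn_iff_integrable_of_support_subset ?_).1 (hint k hk) |>.integrableOn
    intro x hx
    exact subset_tsupport _ (right_ne_zero_of_mul hx)
  have hz : ∀ x, x ∉ Ioo 0 T → φ x = 0 := fun x hx => image_eq_zero_of_notMem_tsupport
    (fun h => hx (hs h))
  have hA : ∫ t in Ioo 0 T, g t * φ t = ∫ t in Ioo 0 T, g' t * φ t := by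
    have := (hi φ hφ hc hs).symm.trans (hi' φ hφ hc hs)
    simpa using this
  rw [← setIntegral_eq_integral_of_forall_compl_eq_zero (s := Ioo 0 T)
    (fun x hx => by simp [hz x hx])]
  calc ∫ x in Ioo 0 T, φ x • (g - g') x = ∫ x in Ioo 0 T, (g x * φ x - g' x * φ x) := by
        congr 1; ext x; simp; ring
    _ = 0 := by
        rw [integral_sub (hint' g hg) (hint' g' hg'), hA, sub_self]

lemma HasWeakDeriv.hasWeakDeriv_weakDeriv {T : ℝ} {f g : ℝ → ℝ} (h : HasWeakDeriv T f g) :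
    HasWeakDeriv T f (weakDeriv T f) := by
  have hex : ∃ g, HasWeakDeriv T f g := ⟨g, h⟩
  rw [weakDeriv, dif_pos hex]
  exact hex.choose_spec

lemma HasWeakDeriv.weakDeriv_ae_eq {T : ℝ} {f g : ℝ → ℝ} (h : HasWeakDeriv T f g) :
    weakDeriv T f =ᵐ[timeMeasure T] g :=
  h.hasWeakDeriv_weakDeriv.ae_unique h

lemma intervalIntegrable_of_integrable_timeMeasure {T : ℝ} (hT : 0 < T) {g : ℝ → ℝ}
    (hg : Integrable g (timeMeasure T)) : IntervalIntegrable g volume 0 T := by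
  rw [intervalIntegrable_iff_integrableOn_Ioo_of_le hT.le]
  exact hg

/-- A function that is almost everywhere equal to `c + ∫₀ᵗ g` with `g` integrable has the weak
derivative `g`: this is integration by parts for absolutely continuous functions. -/
lemma hasWeakDeriv_of_ae_eq_primitive {T : ℝ} (hT : 0 < T) {f g : ℝ → ℝ} {c : ℝ}
    (hg : Integrable g (timeMeasure T))
    (hf : f =ᵐ[timeMeasure T] fun t => c + ∫ s in (0 : ℝ)..t, g s) : HasWeakDeriv T f g := by
  have hgi := intervalIntegrable_of_integrable_timeMeasure hT hg
  set G : ℝ → ℝ := fun t => ∫ s in (0 : ℝ)..t, g s with hG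
  have hGac : AbsolutelyContinuousOnInterval G 0 T :=
    hgi.absolutelyContinuousOnInterval_intervalIntegral (by simp)
  have hGc : ContinuousOn G (Icc 0 T) := by
    have := hGac.continuousOn
    rwa [uIcc_of_le hT.le] at this
  have hcG : IntegrableOn (fun t => c + G t) (Ioo 0 T) :=
    ((continuousOn_const.add hGc).integrableOn_Icc).mono_set Ioo_subset_Icc_self
  refine ⟨IntegrableOn.locallyIntegrableOn (hcG.congr hf.symm), IntegrableOn.locallyIntegrableOn hg,
    fun φ hφ hc hs => ?_⟩
  have hφ0 : φ 0 = 0 := image_eq_zero_of_notMem_tsupport fun h => (hs h).1.false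
  have hφT : φ T = 0 := image_eq_zero_of_notMem_tsupport fun h => (hs h).2.false
  have hφac : AbsolutelyContinuousOnInterval φ 0 T := by
    refine ContDiffOn.absolutelyContinuousOnInterval ?_
    exact (hφ.of_le (by simp)).contDiffOn
  have hφd : ContinuousOn (deriv φ) (uIcc 0 T) :=
    (hφ.continuous_deriv (by simp)).continuousOn
  have h1 : ∫ t in Ioo 0 T, f t * deriv φ t = ∫ t in Ioo 0 T, (c + G t) * deriv φ t := by
    refine integral_congr_ae ?_
    filter_upwards [show f =ᵐ[volume.restrict (Ioo 0 T)] fun t => c + G t from hf] with t ht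
    rw [ht]
  have h2 : ∫ t in (0 : ℝ)..T, deriv φ t = 0 := by
    rw [hφac.integral_deriv_eq_sub, hφ0, hφT, sub_zero]
  have h3 : ∫ t in (0 : ℝ)..T, deriv G t * φ t = ∫ t in (0 : ℝ)..T, g t * φ t := by
    refine intervalIntegral.integral_congr_ae ?_
    filter_upwards [hgi.ae_hasDerivAt_integral] with t ht htm
    rw [(ht (uIoc_subset_uIcc htm) 0 (by simp)).deriv]
  rw [h1, setIntegral_Ioo_eq_intervalIntegral hT, setIntegral_Ioo_eq_intervalIntegral hT]
  calc ∫ t in (0 : ℝ)..T, (c + G t) * deriv φ t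
      = (∫ t in (0 : ℝ)..T, c * deriv φ t) + ∫ t in (0 : ℝ)..T, G t * deriv φ t := by
        rw [← intervalIntegral.integral_add]
        · congr 1; ext t; ring
        · exact (hφd.intervalIntegrable).const_mul c
        · exact (hGac.continuousOn.mul hφd).intervalIntegrable
    _ = - ∫ t in (0 : ℝ)..T, g t * φ t := by
        rw [intervalIntegral.integral_const_mul, h2,
          hGac.integral_mul_deriv_eq_deriv_mul hφac, hφ0, hφT, h3]
        ring

/-! ### Plancherel's theorem for integrable functions -/

section Fourier
open FourierTransform SchwartzMap

lemma integral_schwartz_smul_fourier {G : ℝ → ℂ} (hG : Integrable G) (φ : 𝓢(ℝ, ℂ)) :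
    ∫ x, (𝓕 φ) x • G x = ∫ x, φ x • 𝓕 G x := by
  have := VectorFourier.integral_fourierIntegral_smul_eq_flip (e := Real.fourierChar)
    (μ := volume) (ν := volume) (L := innerₗ ℝ) (f := φ) (g := G) Real.continuous_fourierChar
    (by exact continuous_inner) φ.integrable hG
  rw [flip_innerₗ] at this
  simp only [fourier_coe]
  exact this

/-- The same duality for the Fourier transform of `L²`, which is defined by extension from Schwartz
functions. -/
lemma integral_schwartz_smul_fourier_L2 (H : Lp ℂ 2 (volume : Measure ℝ)) (φ : 𝓢(ℝ, ℂ)) :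
    ∫ x, (𝓕 φ) x • H x = ∫ x, φ x • (𝓕 H : Lp ℂ 2 (volume : Measure ℝ)) x := by
  have := congrArg (fun D => D φ) (Lp.fourier_toTemperedDistribution_eq H)
  simpa only [TemperedDistribution.fourier_apply, Lp.toTemperedDistribution_apply] using this

lemma ae_eq_of_forall_integral_schwartz_smul {A B : ℝ → ℂ} (hA : LocallyIntegrable A)
    (hB : LocallyIntegrable B) (h : ∀ φ : 𝓢(ℝ, ℂ), ∫ x, φ x • A x = ∫ x, φ x • B x) :
    A =ᵐ[volume] B := by
  refine ae_eq_of_integral_contDiff_smul_eq hA hB fun g hg hc => ?_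
  have hg₁ : HasCompactSupport (Complex.ofRealCLM ∘ g) := hc.comp_left rfl
  have hg₂ : ContDiff ℝ ∞ (Complex.ofRealCLM ∘ g) := by fun_prop
  simpa using h (hg₁.toSchwartzMap hg₂)

lemma continuous_fourier {G : ℝ → ℂ} (hG : Integrable G) : Continuous (𝓕 G) :=
  VectorFourier.fourierIntegral_continuous Real.continuous_fourierChar
    (by exact continuous_inner) hG

lemma norm_fourier_le {G : ℝ → ℂ} (ξ : ℝ) : ‖𝓕 G ξ‖ ≤ ∫ x, ‖G x‖ :=
  VectorFourier.norm_fourierIntegral_le_integral_norm _ _ _ _ _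

/-- On `L¹ ∩ L²` the Fourier transform of `L²` is given by the Fourier integral. -/
lemma fourier_ae_eq_of_ae_eq {G : ℝ → ℂ} (hG : Integrable G) {H : Lp ℂ 2 (volume : Measure ℝ)}
    (h : H =ᵐ[volume] G) : (𝓕 H : Lp ℂ 2 (volume : Measure ℝ)) =ᵐ[volume] 𝓕 G := by
  refine ae_eq_of_forall_integral_schwartz_smul
    ((Lp.memLp _).locallyIntegrable (by norm_num)) (continuous_fourier hG).locallyIntegrable
    fun φ => ?_
  rw [← integral_schwartz_smul_fourier_L2, ← integral_schwartz_smul_fourier hG]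
  refine integral_congr_ae ?_
  filter_upwards [h] with x hx
  rw [hx]

/-- An `L¹` function whose Fourier integral agrees with the Fourier transform of an `L²` function
agrees with that `L²` function. -/
lemma ae_eq_of_fourier_ae_eq {G : ℝ → ℂ} (hG : Integrable G) {H : Lp ℂ 2 (volume : Measure ℝ)}
    (h : (𝓕 H : Lp ℂ 2 (volume : Measure ℝ)) =ᵐ[volume] 𝓕 G) : H =ᵐ[volume] G := by
  refine ae_eq_of_forall_integral_schwartz_smul
    ((Lp.memLp _).locallyIntegrable (by norm_num)) hG.locallyIntegrable fun φ => ?_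
  have hφ : φ = 𝓕 (𝓕⁻ φ) := (fourier_fourierInv_eq φ).symm
  rw [hφ, integral_schwartz_smul_fourier_L2, integral_schwartz_smul_fourier hG]
  refine integral_congr_ae ?_
  filter_upwards [h] with x hx
  rw [hx]

lemma eLpNorm_fourier_of_memLp {G : ℝ → ℂ} (hG : Integrable G) (h2 : MemLp G 2) :
    eLpNorm (𝓕 G) 2 = eLpNorm G 2 := by
  rw [← eLpNorm_congr_ae (fourier_ae_eq_of_ae_eq hG h2.coeFn_toLp), ← Lp.enorm_def]
  rw [show ‖(𝓕 h2.toLp : Lp ℂ 2 (volume : Measure ℝ))‖ₑ = ‖h2.toLp‖ₑ by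
    rw [← ofReal_norm, ← ofReal_norm, Lp.norm_fourier_eq], Lp.enorm_toLp]

/-- Plancherel's identity for an `L¹` function whose Fourier integral is in `L²`; that the function
itself is in `L²` is part of the conclusion. -/
lemma eLpNorm_fourier_of_memLp_fourier {G : ℝ → ℂ} (hG : Integrable G) (h2 : MemLp (𝓕 G) 2) :
    eLpNorm (𝓕 G) 2 = eLpNorm G 2 := by
  set H : Lp ℂ 2 (volume : Measure ℝ) := 𝓕⁻ h2.toLp with hH
  have hFH : 𝓕 H = h2.toLp := fourier_fourierInv_eq _
  have hHG : H =ᵐ[volume] G := ae_eq_of_fourier_ae_eq hG (by rw [hFH]; exact h2.coeFn_toLp)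
  exact eLpNorm_fourier_of_memLp hG ((memLp_congr_ae hHG).1 (Lp.memLp H))

end Fourier

section Fourier
open FourierTransform

/-! ### The Fourier transform of a decreasing kernel -/

/-- Translation by half a period changes the sign of the character. -/
lemma norm_fourier_le_half_integral_norm_sub {G : ℝ → ℂ} (hG : Integrable G) {ξ : ℝ}
    (hξ : ξ ≠ 0) : ‖𝓕 G ξ‖ ≤ 1 / 2 * ∫ v, ‖G v - G (v + 1 / (2 * |ξ|))‖ := by
  have h1 := fourierIntegral_eq_half_sub_half_period_translate hξ hG
  have h2 : ‖𝓕 G ξ‖ ≤ 1 / 2 * ∫ v, ‖G v - G (v + (1 / (2 * ‖ξ‖ ^ 2) : ℝ) • ξ)‖ := by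
    rw [Real.fourier_eq, h1, norm_smul]
    simp only [norm_div, norm_one, Complex.norm_ofNat]
    gcongr
    refine (norm_integral_le_integral_norm _).trans (le_of_eq ?_)
    simp only [Circle.norm_smul]
  refine h2.trans (le_of_eq ?_)
  congr 1
  rcases lt_or_gt_of_ne hξ with h | h
  · rw [← integral_add_right_eq_self _ (1 / (2 * |ξ|))]
    congr 1 with v
    have : v + 1 / (2 * |ξ|) + (1 / (2 * ‖ξ‖ ^ 2) : ℝ) • ξ = v := by
      rw [Real.norm_eq_abs, abs_of_neg h, smul_eq_mul]
      field_simp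
      ring
    rw [this, norm_sub_rev]
  · congr 1 with v
    have : (1 / (2 * ‖ξ‖ ^ 2) : ℝ) • ξ = 1 / (2 * |ξ|) := by
      rw [Real.norm_eq_abs, abs_of_pos h, smul_eq_mul]
      field_simp
    rw [this]

/-- The `L¹` modulus of continuity of a kernel that vanishes on `(-∞, 0]` and decreases on
`(0, ∞)`. -/
lemma integral_abs_sub_translate_of_antitoneOn {k : ℝ → ℝ} (hk : Integrable k)
    (hk0 : ∀ t, 0 ≤ k t) (hkz : ∀ t ≤ 0, k t = 0) (hka : AntitoneOn k (Ioi 0)) {a : ℝ}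
    (ha : 0 ≤ a) : ∫ v, |k v - k (v + a)| = 2 * ∫ v in Ioc 0 a, k v := by
  -- The difference is `k v - k (v + a)` for `v > 0` and `-k (v + a)` for `v ≤ 0`, where only
  -- `-a < v` contributes.
  have hpt : ∀ v, |k v - k (v + a)|
      = (k v - k (v + a)) + 2 * (Ioc 0 a).indicator k (v + a) := by
    intro v
    rcases le_or_gt v 0 with hv | hv
    · rw [hkz v hv, zero_sub, abs_neg, abs_of_nonneg (hk0 _)]
      rcases le_or_gt (v + a) 0 with hva | hva
      · rw [hkz _ hva, indicator_of_notMem (fun h => absurd h.1 (not_lt.2 hva))]; ring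
      · rw [indicator_of_mem (show v + a ∈ Ioc 0 a from ⟨hva, by linarith⟩)]; ring
    · rw [indicator_of_notMem (fun h => by have := h.2; linarith), abs_of_nonneg]
      · ring
      · exact sub_nonneg.2 (hka hv (show (0 : ℝ) < v + a by linarith) (by linarith))
  simp_rw [hpt]
  have hi : Integrable ((Ioc 0 a).indicator k) := hk.indicator measurableSet_Ioc
  have hd : Integrable (fun v => k v - k (v + a)) := hk.sub (hk.comp_add_right a)
  rw [integral_add hd ((hi.comp_add_right a).const_mul 2),
    integral_sub hk (hk.comp_add_right a), integral_add_right_eq_self, sub_self, zero_add,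
    integral_const_mul, integral_add_right_eq_self, integral_indicator measurableSet_Ioc]

/-- The Fourier transform of a kernel that vanishes on `(-∞, 0]` and decreases on `(0, ∞)` is
bounded by its integral over half a period. -/
lemma norm_fourier_le_of_antitoneOn {k : ℝ → ℝ} (hk : Integrable k)
    (hk0 : ∀ t, 0 ≤ k t) (hkz : ∀ t ≤ 0, k t = 0) (hka : AntitoneOn k (Ioi 0)) {ξ : ℝ}
    (hξ : ξ ≠ 0) :
    ‖𝓕 (fun t => (k t : ℂ)) ξ‖ ≤ ∫ v in Ioc 0 (1 / (2 * |ξ|)), k v := by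
  have hkc : Integrable (fun t => (k t : ℂ)) := hk.ofReal
  refine (norm_fourier_le_half_integral_norm_sub hkc hξ).trans (le_of_eq ?_)
  have : ∀ v, ‖(k v : ℂ) - (k (v + 1 / (2 * |ξ|)) : ℂ)‖ = |k v - k (v + 1 / (2 * |ξ|))| := by
    intro v
    rw [← Complex.ofReal_sub, Complex.norm_real, Real.norm_eq_abs]
  simp_rw [this]
  rw [integral_abs_sub_translate_of_antitoneOn hk hk0 hkz hka (by positivity)]
  ring

/-! ### Gagliardo integrals of convolutions -/

/-- The constant `∫ |e^{2πih} - 1|² / |h|^{1+2θ} dh` that links the Gagliardo seminorm of order `θ`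
with the Fourier multiplier `|ξ|^θ`. -/
noncomputable def gagliardoConst (θ : ℝ) : ℝ≥0∞ :=
  ∫⁻ h : ℝ, ‖(Real.fourierChar h : ℂ) - 1‖ₑ ^ 2 / ENNReal.ofReal (|h| ^ (1 + 2 * θ))

lemma norm_fourierChar_sub_one_le (h : ℝ) : ‖(Real.fourierChar h : ℂ) - 1‖ ≤ 2 * Real.pi * |h| := by
  have := Real.norm_exp_I_mul_ofReal_sub_one_le (x := 2 * Real.pi * h)
  rw [Real.fourierChar_apply, mul_comm]
  refine this.trans (le_of_eq ?_)
  rw [norm_mul, Real.norm_eq_abs, Real.norm_eq_abs, abs_of_pos (by positivity)]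

lemma norm_fourierChar_sub_one_le_two (h : ℝ) : ‖(Real.fourierChar h : ℂ) - 1‖ ≤ 2 := by
  refine (norm_sub_le _ _).trans ?_
  rw [Circle.norm_coe, norm_one]
  norm_num

lemma gagliardoConst_lt_top {θ : ℝ} (h0 : 0 < θ) (h1 : θ < 1) : gagliardoConst θ < ⊤ := by
  -- The two bounds `|e^{2πih} - 1| ≤ 2π|h|` and `|e^{2πih} - 1| ≤ 2` make the integrand integrable
  -- near zero because `θ < 1` and near infinity because `θ > 0`.
  set b : ℝ → ℝ := fun x => if x ≤ 1 then (2 * Real.pi) ^ 2 * x ^ (1 - 2 * θ)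
    else 4 * x ^ (-1 - 2 * θ) with hb
  have hbi : IntegrableOn b (Ioi 0) := by
    rw [← Ioc_union_Ioi_eq_Ioi (zero_le_one' ℝ)]
    refine IntegrableOn.union ?_ ?_
    · have : IntegrableOn (fun x : ℝ => (2 * Real.pi) ^ 2 * x ^ (1 - 2 * θ)) (Ioc 0 1) := by
        refine Integrable.const_mul ?_ _
        rw [← IntegrableOn, ← intervalIntegrable_iff_integrableOn_Ioc_of_le zero_le_one]
        exact intervalIntegral.intervalIntegrable_rpow' (by linarith)
      refine this.congr_fun (fun x hx => ?_) measurableSet_Ioc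
      simp only [hb, if_pos hx.2]
    · have : IntegrableOn (fun x : ℝ => 4 * x ^ (-1 - 2 * θ)) (Ioi 1) :=
        (integrableOn_Ioi_rpow_of_lt (by linarith) one_pos).const_mul _
      refine this.congr_fun (fun x hx => ?_) measurableSet_Ioi
      simp only [hb, if_neg (not_le.2 (mem_Ioi.1 hx))]
  have hpt : ∀ h : ℝ, h ≠ 0 →
      ‖(Real.fourierChar h : ℂ) - 1‖ₑ ^ 2 / ENNReal.ofReal (|h| ^ (1 + 2 * θ))
        ≤ ENNReal.ofReal (b |h|) := by
    intro h hh
    have hp : 0 < |h| := abs_pos.2 hh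
    rw [← ofReal_norm, ← ENNReal.ofReal_pow (norm_nonneg _),
      ← ENNReal.ofReal_div_of_pos (by positivity)]
    refine ENNReal.ofReal_le_ofReal ?_
    rw [div_le_iff₀ (by positivity)]
    by_cases hle : |h| ≤ 1
    · simp only [hb, if_pos hle]
      rw [mul_assoc, ← Real.rpow_add hp, show 1 - 2 * θ + (1 + 2 * θ) = (2 : ℕ) by push_cast; ring,
        Real.rpow_natCast, ← mul_pow]
      gcongr
      exact norm_fourierChar_sub_one_le h
    · simp only [hb, if_neg hle]
      rw [mul_assoc, ← Real.rpow_add hp, show -1 - 2 * θ + (1 + 2 * θ) = 0 by ring,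
        Real.rpow_zero, mul_one]
      calc _ ≤ (2 : ℝ) ^ 2 := by gcongr; exact norm_fourierChar_sub_one_le_two h
        _ = 4 := by norm_num
  have hae : ∀ᵐ h : ℝ, h ≠ 0 := by simp [ae_iff, measure_singleton]
  calc gagliardoConst θ ≤ ∫⁻ h : ℝ, ENNReal.ofReal (b |h|) :=
        lintegral_mono_ae (hae.mono hpt)
    _ = (∫⁻ h in Ioi (0 : ℝ), ENNReal.ofReal (b |h|))
          + ∫⁻ h in (Ioi (0 : ℝ))ᶜ, ENNReal.ofReal (b |h|) :=
        (lintegral_add_compl _ measurableSet_Ioi).symm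
    _ = (∫⁻ h in Ioi (0 : ℝ), ENNReal.ofReal (b |h|))
          + ∫⁻ h in Ioi (0 : ℝ), ENNReal.ofReal (b |h|) := by
        congr 1
        rw [compl_Ioi, ← setLIntegral_congr (Iio_ae_eq_Iic (a := (0 : ℝ)))]
        have := (Measure.measurePreserving_neg (volume : Measure ℝ)).setLIntegral_comp_preimage_emb
          (MeasurableEquiv.neg ℝ).measurableEmbedding (fun h => ENNReal.ofReal (b |h|)) (Ioi 0)
        rw [← this]
        simp
    _ < ⊤ := by
        have : ∫⁻ h in Ioi (0 : ℝ), ENNReal.ofReal (b |h|) < ⊤ := by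
          refine lt_of_le_of_lt (le_of_eq ?_) hbi.hasFiniteIntegral
          refine setLIntegral_congr_fun measurableSet_Ioi fun x hx => ?_
          have hx0 : 0 < x := hx
          simp only [abs_of_pos hx0]
          rw [← ofReal_norm, Real.norm_of_nonneg]
          simp only [hb]
          split_ifs <;> positivity
        exact ENNReal.add_lt_top.2 ⟨this, this⟩

lemma lintegral_fourierChar_sub_one_scaled (θ : ℝ) {ξ : ℝ} (hξ : ξ ≠ 0) :
    ∫⁻ h : ℝ, ‖(Real.fourierChar (h * ξ) : ℂ) - 1‖ₑ ^ 2 / ENNReal.ofReal (|h| ^ (1 + 2 * θ))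
      = ENNReal.ofReal (|ξ| ^ (2 * θ)) * gagliardoConst θ := by
  have hp : 0 < |ξ| := abs_pos.2 hξ
  have hmeas : Measurable fun x : ℝ =>
      ‖(Real.fourierChar x : ℂ) - 1‖ₑ ^ 2 / ENNReal.ofReal (|x| ^ (1 + 2 * θ)) := by
    have : Continuous fun x : ℝ => (Real.fourierChar x : ℂ) :=
      continuous_subtype_val.comp Real.continuous_fourierChar
    fun_prop
  have h1 : ∀ h : ℝ, ‖(Real.fourierChar (h * ξ) : ℂ) - 1‖ₑ ^ 2 / ENNReal.ofReal (|h| ^ (1 + 2 * θ))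
      = ENNReal.ofReal (|ξ| ^ (1 + 2 * θ)) * (‖(Real.fourierChar (ξ * h) : ℂ) - 1‖ₑ ^ 2 /
        ENNReal.ofReal (|ξ * h| ^ (1 + 2 * θ))) := by
    intro h
    rw [abs_mul, Real.mul_rpow (abs_nonneg _) (abs_nonneg _), ENNReal.ofReal_mul (by positivity),
      mul_comm h ξ, ← mul_div_assoc, ENNReal.mul_div_mul_left]
    · simp only [ne_eq, ENNReal.ofReal_eq_zero, not_le]; positivity
    · exact ENNReal.ofReal_ne_top
  simp_rw [h1]
  rw [lintegral_const_mul _ (by fun_prop)]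
  have h2 : ∫⁻ h : ℝ, (‖(Real.fourierChar (ξ * h) : ℂ) - 1‖ₑ ^ 2 /
        ENNReal.ofReal (|ξ * h| ^ (1 + 2 * θ))) = ENNReal.ofReal |ξ⁻¹| * gagliardoConst θ := by
    rw [← lintegral_map (g := fun h => ξ * h) hmeas (by fun_prop),
      Real.map_volume_mul_left hξ, lintegral_smul_measure]
    rfl
  rw [h2, ← mul_assoc, ← ENNReal.ofReal_mul (by positivity), Real.rpow_add hp, Real.rpow_one,
    abs_inv]
  congr 2
  field_simp

end Fourier

lemma eLpNorm_two_sq {α E : Type*} [MeasurableSpace α] [NormedAddCommGroup E] (f : α → E)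
    (μ : Measure α) : eLpNorm f 2 μ ^ 2 = ∫⁻ x, ‖f x‖ₑ ^ 2 ∂μ := by
  have := eLpNorm_nnreal_pow_eq_lintegral (f := f) (μ := μ) (p := 2) two_ne_zero
  simpa using this

section Fourier
open FourierTransform

lemma fourier_translate_sub {f : ℝ → ℂ} (hf : Integrable f) (h ξ : ℝ) :
    𝓕 (fun t => f (t + h) - f t) ξ = ((Real.fourierChar (h * ξ) : ℂ) - 1) * 𝓕 f ξ := by
  have h1 : 𝓕 (fun t => f (t + h)) ξ = (Real.fourierChar (h * ξ) : ℂ) * 𝓕 f ξ := by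
    have := congrFun (VectorFourier.fourierIntegral_comp_add_right Real.fourierChar volume
      (innerₗ ℝ) f h) ξ
    simp only [innerₗ_apply_apply, Circle.smul_def, smul_eq_mul] at this
    rw [show inner ℝ h ξ = h * ξ by simp [mul_comm]] at this
    exact this
  rw [sub_mul, one_mul, ← h1]
  have hi : ∀ {g : ℝ → ℂ}, Integrable g →
      Integrable fun v : ℝ => Real.fourierChar (-inner ℝ v ξ) • g v :=
    fun hg => (Real.fourierIntegral_convergent_iff ξ).2 hg
  simp only [Real.fourier_eq]
  rw [← integral_sub (hi (hf.comp_add_right h)) (hi hf)]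
  simp only [smul_sub]

lemma lintegral_enorm_translate_sub_sq {f W : ℝ → ℂ} (hf : Integrable f) (hW : Integrable W)
    (hW2 : MemLp W 2) {B : ℝ} (hB : ∀ ξ, ‖𝓕 f ξ‖ ≤ B * ‖𝓕 W ξ‖) (h : ℝ) :
    ∫⁻ t, ‖f (t + h) - f t‖ₑ ^ 2
      = ∫⁻ ξ, ‖(Real.fourierChar (h * ξ) : ℂ) - 1‖ₑ ^ 2 * ‖𝓕 f ξ‖ₑ ^ 2 := by
  have hg : Integrable fun t => f (t + h) - f t := (hf.comp_add_right h).sub hf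
  have hFW : MemLp (𝓕 W) 2 := by
    refine ⟨(continuous_fourier hW).aestronglyMeasurable, ?_⟩
    rw [eLpNorm_fourier_of_memLp hW hW2]
    exact hW2.2
  have hFg : MemLp (𝓕 fun t => f (t + h) - f t) 2 := by
    refine hFW.of_le_mul (c := 2 * B) (continuous_fourier hg).aestronglyMeasurable
      (Filter.Eventually.of_forall fun ξ => ?_)
    rw [fourier_translate_sub hf, norm_mul, mul_assoc]
    exact mul_le_mul (norm_fourierChar_sub_one_le_two _) (hB ξ) (norm_nonneg _) zero_le_two
  rw [← eLpNorm_two_sq, ← eLpNorm_fourier_of_memLp_fourier hg hFg, eLpNorm_two_sq]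
  refine lintegral_congr fun ξ => ?_
  rw [fourier_translate_sub hf, enorm_mul, mul_pow]

lemma ofReal_rpow_mul_enorm_sq_le {x A θ : ℝ} (hx : 0 < x) {z w : ℂ}
    (h : ‖z‖ ≤ A * x ^ (-θ) * ‖w‖) :
    ENNReal.ofReal (x ^ (2 * θ)) * ‖z‖ₑ ^ 2 ≤ ENNReal.ofReal (A ^ 2) * ‖w‖ₑ ^ 2 := by
  rw [← ofReal_norm, ← ofReal_norm, ← ENNReal.ofReal_pow (norm_nonneg _),
    ← ENNReal.ofReal_pow (norm_nonneg _), ← ENNReal.ofReal_mul (by positivity),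
    ← ENNReal.ofReal_mul (by positivity)]
  refine ENNReal.ofReal_le_ofReal ?_
  have h2 := pow_le_pow_left₀ (norm_nonneg _) h 2
  calc x ^ (2 * θ) * ‖z‖ ^ 2 ≤ x ^ (2 * θ) * (A * x ^ (-θ) * ‖w‖) ^ 2 := by gcongr
    _ = (x ^ (2 * θ) * (x ^ (-θ)) ^ 2) * (A ^ 2 * ‖w‖ ^ 2) := by ring
    _ = A ^ 2 * ‖w‖ ^ 2 := by
      rw [← Real.rpow_natCast (x ^ (-θ)) 2, ← Real.rpow_mul hx.le, ← Real.rpow_add hx,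
        show 2 * θ + -θ * (2 : ℕ) = 0 by push_cast; ring, Real.rpow_zero, one_mul]

/-- If the Fourier transform of `f` is dominated by `|ξ|^{-θ}` times that of an `L²` function `W`,
then `f` has a finite Gagliardo seminorm of order `θ`, bounded by the norm of `W`. -/
lemma lintegral_gagliardo_le {f W : ℝ → ℂ} (hf : Integrable f) (hW : Integrable W)
    (hW2 : MemLp W 2) {A B θ : ℝ} (hB : ∀ ξ, ‖𝓕 f ξ‖ ≤ B * ‖𝓕 W ξ‖)
    (hA : ∀ ξ, ξ ≠ 0 → ‖𝓕 f ξ‖ ≤ A * |ξ| ^ (-θ) * ‖𝓕 W ξ‖) :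
    ∫⁻ h : ℝ, (∫⁻ t, ‖f (t + h) - f t‖ₑ ^ 2) / ENNReal.ofReal (|h| ^ (1 + 2 * θ))
      ≤ ENNReal.ofReal (A ^ 2) * gagliardoConst θ * eLpNorm W 2 ^ 2 := by
  have hmf : Measurable fun ξ => ‖𝓕 f ξ‖ₑ ^ 2 :=
    (continuous_fourier hf).measurable.enorm.pow_const 2
  have hmW : Measurable fun ξ => ‖𝓕 W ξ‖ₑ ^ 2 :=
    (continuous_fourier hW).measurable.enorm.pow_const 2
  set m : ℝ → ℝ → ℝ≥0∞ := fun h ξ => ‖(Real.fourierChar (h * ξ) : ℂ) - 1‖ₑ ^ 2 /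
      ENNReal.ofReal (|h| ^ (1 + 2 * θ)) with hm
  have hce : Measurable fun p : ℝ × ℝ => (Real.fourierChar (p.1 * p.2) : ℂ) :=
    (continuous_subtype_val.comp (Real.continuous_fourierChar.comp
      (continuous_fst.mul continuous_snd))).measurable
  have hmm : Measurable (Function.uncurry m) := by
    refine ((hce.sub_const 1).enorm.pow_const 2).div ?_
    fun_prop
  have hm1 : ∀ h, Measurable fun ξ => m h ξ := fun h => hmm.of_uncurry_left
  have hm2 : ∀ ξ, Measurable fun h => m h ξ := fun ξ => hmm.of_uncurry_right
  have hae : ∀ᵐ h : ℝ, h ≠ 0 := by simp [ae_iff, measure_singleton]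
  have hstep : ∀ h : ℝ, (∫⁻ t, ‖f (t + h) - f t‖ₑ ^ 2) / ENNReal.ofReal (|h| ^ (1 + 2 * θ))
      = ∫⁻ ξ : ℝ, m h ξ * ‖𝓕 f ξ‖ₑ ^ 2 := by
    intro h
    have hme : Measurable fun ξ => ‖(Real.fourierChar (h * ξ) : ℂ) - 1‖ₑ ^ 2 * ‖𝓕 f ξ‖ₑ ^ 2 :=
      (((hce.comp measurable_prodMk_left).sub_const 1).enorm.pow_const 2).mul hmf
    rw [lintegral_enorm_translate_sub_sq hf hW hW2 hB, div_eq_mul_inv, ← lintegral_mul_const _ hme]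
    refine lintegral_congr fun ξ => ?_
    simp only [hm]
    rw [div_eq_mul_inv, mul_right_comm]
  have hbound : ∀ ξ : ℝ, ξ ≠ 0 → ∫⁻ h : ℝ, m h ξ * ‖𝓕 f ξ‖ₑ ^ 2
      ≤ ENNReal.ofReal (A ^ 2) * gagliardoConst θ * ‖𝓕 W ξ‖ₑ ^ 2 := by
    intro ξ hξ
    rw [lintegral_mul_const _ (hm2 ξ)]
    simp only [hm]
    rw [lintegral_fourierChar_sub_one_scaled θ hξ,
      mul_right_comm, mul_right_comm _ (gagliardoConst θ)]
    gcongr ?_ * _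
    exact ofReal_rpow_mul_enorm_sq_le (abs_pos.2 hξ) (hA ξ hξ)
  simp only [hstep]
  rw [lintegral_lintegral_swap (hmm.mul (hmf.comp measurable_snd)).aemeasurable]
  refine (lintegral_mono_ae (hae.mono hbound)).trans (le_of_eq ?_)
  rw [lintegral_const_mul _ hmW, ← eLpNorm_two_sq, eLpNorm_fourier_of_memLp hW hW2]

/-- The `L²` case of the same principle: a bounded Fourier multiplier is bounded on `L²`. -/
lemma eLpNorm_le_of_fourier_le {f W : ℝ → ℂ} (hf : Integrable f) (hW : Integrable W)
    (hW2 : MemLp W 2) {B : ℝ} (hB : ∀ ξ, ‖𝓕 f ξ‖ ≤ B * ‖𝓕 W ξ‖) :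
    eLpNorm f 2 ≤ ENNReal.ofReal B * eLpNorm W 2 := by
  have hFW : MemLp (𝓕 W) 2 := by
    refine ⟨(continuous_fourier hW).aestronglyMeasurable, ?_⟩
    rw [eLpNorm_fourier_of_memLp hW hW2]
    exact hW2.2
  have hFf : MemLp (𝓕 f) 2 := hFW.of_le_mul (continuous_fourier hf).aestronglyMeasurable
    (Filter.Eventually.of_forall hB)
  rw [← eLpNorm_fourier_of_memLp_fourier hf hFf, ← eLpNorm_fourier_of_memLp hW hW2]
  exact eLpNorm_le_mul_eLpNorm_of_ae_le_mul (Filter.Eventually.of_forall hB) 2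

/-- The Gagliardo double integral in difference variables. -/
lemma lintegral_lintegral_gagliardo_eq {f : ℝ → ℂ} (hf : AEStronglyMeasurable f) (θ : ℝ) :
    ∫⁻ t, ∫⁻ s, ‖f t - f s‖ₑ ^ 2 / ENNReal.ofReal (|t - s| ^ (1 + 2 * θ))
      = ∫⁻ h : ℝ, (∫⁻ t, ‖f (t + h) - f t‖ₑ ^ 2) / ENNReal.ofReal (|h| ^ (1 + 2 * θ)) := by
  have hadd : Measure.QuasiMeasurePreserving (fun p : ℝ × ℝ => p.1 + p.2)
      ((volume : Measure ℝ).prod volume) volume := quasiMeasurePreserving_add _ _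
  have hm1 : AEMeasurable (fun p : ℝ × ℝ => f (p.1 + p.2)) ((volume : Measure ℝ).prod volume) :=
    (hf.comp_quasiMeasurePreserving hadd).aemeasurable
  have hm2 : AEMeasurable (fun p : ℝ × ℝ => f p.1) ((volume : Measure ℝ).prod volume) :=
    (hf.comp_quasiMeasurePreserving Measure.quasiMeasurePreserving_fst).aemeasurable
  calc ∫⁻ t, ∫⁻ s, ‖f t - f s‖ₑ ^ 2 / ENNReal.ofReal (|t - s| ^ (1 + 2 * θ))
      = ∫⁻ t, ∫⁻ h, ‖f (t + h) - f t‖ₑ ^ 2 / ENNReal.ofReal (|h| ^ (1 + 2 * θ)) := by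
        refine lintegral_congr fun t => ?_
        rw [← lintegral_add_left_eq_self _ t]
        refine lintegral_congr fun h => ?_
        rw [sub_add_cancel_left, abs_neg, ← enorm_neg, neg_sub]
    _ = ∫⁻ h, ∫⁻ t, ‖f (t + h) - f t‖ₑ ^ 2 / ENNReal.ofReal (|h| ^ (1 + 2 * θ)) := by
        refine lintegral_lintegral_swap ?_
        refine ((hm1.sub hm2).enorm.pow_const 2).div ?_
        refine Measurable.aemeasurable ?_
        fun_prop
    _ = _ := by
        refine lintegral_congr fun h => ?_
        simp only [div_eq_mul_inv]
        refine lintegral_mul_const'' _ ?_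
        have : AEMeasurable fun t => f (t + h) :=
          (hf.comp_quasiMeasurePreserving
            (measurePreserving_add_right volume h).quasiMeasurePreserving).aemeasurable
        have := hf.aemeasurable
        fun_prop

end Fourier

/-! ### Riemann–Liouville integrals as convolutions on the line -/

/-- The Riemann–Liouville kernel `t ^ (θ - 1) / Γ(θ)`, cut off to `(0,T)`. -/
noncomputable def rlKernel (θ T : ℝ) : ℝ → ℝ :=
  (Ioo 0 T).indicator fun t => t ^ (θ - 1) / Real.Gamma θ

/-- The convolution on the whole line of `w`, extended by `0` outside `(0,T)`, with the cut-off
kernel. It agrees with `fracIntegral θ w` on `(0,T)` and vanishes on `(-∞, 0]`. -/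
noncomputable def rlConv (θ T : ℝ) (w : ℝ → ℝ) (t : ℝ) : ℝ :=
  ∫ s, (Ioo 0 T).indicator w s * rlKernel θ T (t - s)

lemma integrableOn_rpow_div_Gamma {θ a : ℝ} (hθ : 0 < θ) (ha : 0 ≤ a) :
    IntegrableOn (fun t : ℝ => t ^ (θ - 1) / Real.Gamma θ) (Ioc 0 a) := by
  refine Integrable.div_const ?_ _
  rw [← IntegrableOn, ← intervalIntegrable_iff_integrableOn_Ioc_of_le ha]
  exact intervalIntegral.intervalIntegrable_rpow' (by linarith)

lemma integral_rpow_div_Gamma {θ a : ℝ} (hθ : 0 < θ) (ha : 0 ≤ a) :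
    ∫ t in Ioc 0 a, t ^ (θ - 1) / Real.Gamma θ = a ^ θ / Real.Gamma (θ + 1) := by
  rw [← intervalIntegral.integral_of_le ha, intervalIntegral.integral_div,
    integral_rpow (Or.inl (by linarith)), sub_add_cancel, Real.zero_rpow hθ.ne', sub_zero,
    Real.Gamma_add_one hθ.ne', div_div]

lemma rlKernel_nonneg {θ : ℝ} (hθ : 0 < θ) (T t : ℝ) : 0 ≤ rlKernel θ T t := by
  refine indicator_nonneg (fun x hx => ?_) t
  exact div_nonneg (Real.rpow_nonneg hx.1.le _) (Real.Gamma_pos_of_pos hθ).le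

lemma rlKernel_of_nonpos (θ T : ℝ) {t : ℝ} (ht : t ≤ 0) : rlKernel θ T t = 0 :=
  indicator_of_notMem (fun h => absurd h.1 (not_lt.2 ht)) _

lemma integrable_rlKernel {θ T : ℝ} (hθ : 0 < θ) (hT : 0 < T) : Integrable (rlKernel θ T) :=
  ((integrableOn_rpow_div_Gamma hθ hT.le).mono_set Ioo_subset_Ioc_self).integrable_indicator
    measurableSet_Ioo

lemma antitoneOn_rlKernel {θ : ℝ} (hθ : 0 < θ) (hθ1 : θ ≤ 1) (T : ℝ) :
    AntitoneOn (rlKernel θ T) (Ioi 0) := by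
  intro x hx y hy hxy
  by_cases hyT : y < T
  · rw [rlKernel, indicator_of_mem (show x ∈ Ioo 0 T from ⟨hx, hxy.trans_lt hyT⟩),
      indicator_of_mem (show y ∈ Ioo 0 T from ⟨hy, hyT⟩)]
    have := (Real.Gamma_pos_of_pos hθ).le
    gcongr ?_ / _
    exact Real.rpow_le_rpow_of_nonpos hx hxy (by linarith)
  · rw [rlKernel, indicator_of_notMem (fun h => hyT h.2)]
    exact rlKernel_nonneg hθ T x

lemma setIntegral_rlKernel_le {θ T a : ℝ} (hθ : 0 < θ) (hT : 0 < T) (ha : 0 ≤ a) :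
    ∫ t in Ioc 0 a, rlKernel θ T t ≤ a ^ θ / Real.Gamma (θ + 1) := by
  rw [← integral_rpow_div_Gamma hθ ha]
  refine setIntegral_mono_on (integrable_rlKernel hθ hT).integrableOn
    (integrableOn_rpow_div_Gamma hθ ha) measurableSet_Ioc fun x hx => ?_
  by_cases hxT : x ∈ Ioo 0 T
  · rw [rlKernel, indicator_of_mem hxT]
  · rw [rlKernel, indicator_of_notMem hxT]
    exact div_nonneg (Real.rpow_nonneg hx.1.le _) (Real.Gamma_pos_of_pos hθ).le

lemma setIntegral_rlKernel_eq {θ T a : ℝ} (hθ : 0 < θ) (ha : 0 ≤ a) (haT : a < T) :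
    ∫ t in Ioc 0 a, rlKernel θ T t = a ^ θ / Real.Gamma (θ + 1) := by
  rw [← integral_rpow_div_Gamma hθ ha]
  refine setIntegral_congr_fun measurableSet_Ioc fun x hx => ?_
  exact indicator_of_mem (show x ∈ Ioo 0 T from ⟨hx.1, hx.2.trans_lt haT⟩) _

lemma rlConv_of_nonpos (θ T : ℝ) (w : ℝ → ℝ) {t : ℝ} (ht : t ≤ 0) : rlConv θ T w t = 0 := by
  refine integral_eq_zero_of_ae (Filter.Eventually.of_forall fun s => ?_)
  by_cases hs : s ∈ Ioo 0 T
  · simp [rlKernel_of_nonpos θ T (show t - s ≤ 0 by linarith [hs.1])]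
  · simp [indicator_of_notMem hs]

lemma rlConv_eq_fracIntegral (θ : ℝ) {T : ℝ} (w : ℝ → ℝ) {t : ℝ} (ht : t ∈ Ioo 0 T) :
    rlConv θ T w t = fracIntegral θ w t := by
  rw [fracIntegral, intervalIntegral.integral_of_le ht.1.le, integral_Ioc_eq_integral_Ioo,
    ← integral_indicator measurableSet_Ioo, rlConv]
  congr 1 with s
  by_cases hs : s ∈ Ioo 0 t
  · rw [indicator_of_mem hs, indicator_of_mem (show s ∈ Ioo 0 T from ⟨hs.1, hs.2.trans ht.2⟩),
      rlKernel, indicator_of_mem (show t - s ∈ Ioo 0 T from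
        ⟨by linarith [hs.2], by linarith [hs.1, ht.2]⟩), mul_comm]
  · rw [indicator_of_notMem hs]
    by_cases hs0 : 0 < s
    · rw [rlKernel_of_nonpos θ T, mul_zero]
      by_contra h
      exact hs ⟨hs0, by linarith⟩
    · rw [indicator_of_notMem (fun h => hs0 h.1), zero_mul]

lemma integrable_rlConv_integrand {θ T : ℝ} (hθ : 0 < θ) (hT : 0 < T) {w : ℝ → ℝ}
    (hw : Integrable w (timeMeasure T)) :
    Integrable (fun p : ℝ × ℝ => (Ioo 0 T).indicator w p.2 * rlKernel θ T (p.1 - p.2))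
      (volume.prod volume) := by
  have hW : Integrable ((Ioo 0 T).indicator w) := IntegrableOn.integrable_indicator hw
    measurableSet_Ioo
  exact hW.convolution_integrand (ContinuousLinearMap.mul ℝ ℝ) (integrable_rlKernel hθ hT)

lemma integrable_rlConv {θ T : ℝ} (hθ : 0 < θ) (hT : 0 < T) {w : ℝ → ℝ}
    (hw : Integrable w (timeMeasure T)) : Integrable (rlConv θ T w) :=
  (integrable_rlConv_integrand hθ hT hw).integral_prod_left

lemma fracIntegral_ae_eq_rlConv (θ T : ℝ) (w : ℝ → ℝ) :
    fracIntegral θ w =ᵐ[timeMeasure T] rlConv θ T w := by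
  refine (ae_restrict_iff' measurableSet_Ioo).2 (Filter.Eventually.of_forall fun t ht => ?_)
  exact (rlConv_eq_fracIntegral θ w ht).symm

lemma integrable_fracIntegral {θ T : ℝ} (hθ : 0 < θ) (hT : 0 < T) {w : ℝ → ℝ}
    (hw : Integrable w (timeMeasure T)) : Integrable (fracIntegral θ w) (timeMeasure T) :=
  ((integrable_rlConv hθ hT hw).mono_measure Measure.restrict_le_self).congr
    (fracIntegral_ae_eq_rlConv θ T w).symm

/-- The semigroup property `J^{θ+1} = J^1 J^θ`. -/
lemma fracIntegral_add_one {θ T : ℝ} (hθ : 0 < θ) (hT : 0 < T) {w : ℝ → ℝ}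
    (hw : Integrable w (timeMeasure T)) {t : ℝ} (ht : t ∈ Icc 0 T) :
    fracIntegral (θ + 1) w t = ∫ r in (0 : ℝ)..t, fracIntegral θ w r := by
  have hint := integrable_rlConv_integrand hθ hT hw
  have h1 : ∫ r in (0 : ℝ)..t, fracIntegral θ w r
      = ∫ r in Ioc 0 t, ∫ s, (Ioo 0 T).indicator w s * rlKernel θ T (r - s) := by
    rw [intervalIntegral.integral_of_le ht.1, integral_Ioc_eq_integral_Ioo,
      integral_Ioc_eq_integral_Ioo]
    refine setIntegral_congr_fun measurableSet_Ioo fun r hr => ?_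
    exact (rlConv_eq_fracIntegral θ w ⟨hr.1, hr.2.trans_le ht.2⟩).symm
  have hint' : Integrable (fun p : ℝ × ℝ => (Ioo 0 T).indicator w p.2 * rlKernel θ T (p.1 - p.2))
      ((volume.restrict (Ioc 0 t)).prod volume) :=
    hint.mono_measure (Measure.prod_mono Measure.restrict_le_self le_rfl)
  rw [h1, integral_integral_swap hint', fracIntegral, intervalIntegral.integral_of_le ht.1,
    integral_Ioc_eq_integral_Ioo, ← integral_indicator measurableSet_Ioo]
  congr 1 with s
  rw [integral_const_mul]
  by_cases hs0 : 0 < s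
  swap
  · rw [indicator_of_notMem (fun h => hs0 h.1), indicator_of_notMem (fun h => hs0 h.1), zero_mul]
  by_cases hst : s < t
  · rw [indicator_of_mem (show s ∈ Ioo 0 t from ⟨hs0, hst⟩),
      indicator_of_mem (show s ∈ Ioo 0 T from ⟨hs0, hst.trans_le ht.2⟩), mul_comm,
      add_sub_cancel_right]
    congr 1
    have h2 : ∫ r in Ioc 0 t, rlKernel θ T (r - s) = ∫ r in Ioc 0 (t - s), rlKernel θ T r := by
      rw [← integral_indicator measurableSet_Ioc, ← integral_indicator measurableSet_Ioc,
        ← integral_sub_right_eq_self ((Ioc 0 (t - s)).indicator (rlKernel θ T)) s]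
      congr 1 with r
      by_cases hrs : 0 < r - s
      · by_cases hrt : r ≤ t
        · rw [indicator_of_mem (show r ∈ Ioc 0 t from ⟨by linarith, hrt⟩),
            indicator_of_mem (show r - s ∈ Ioc 0 (t - s) from ⟨hrs, by linarith⟩)]
        · rw [indicator_of_notMem (fun h : r ∈ Ioc 0 t => hrt h.2),
            indicator_of_notMem (fun h : r - s ∈ Ioc 0 (t - s) => hrt (by linarith [h.2]))]
      · rw [indicator_of_notMem (fun h : r - s ∈ Ioc 0 (t - s) => hrs h.1)]
        by_cases hr : r ∈ Ioc 0 t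
        · rw [indicator_of_mem hr, rlKernel_of_nonpos θ T (not_lt.1 hrs)]
        · rw [indicator_of_notMem hr]
    rw [h2, setIntegral_rlKernel_eq hθ (by linarith) (by linarith [ht.2])]
  · rw [indicator_of_notMem (fun h : s ∈ Ioo 0 t => hst h.2)]
    have : ∫ r in Ioc 0 t, rlKernel θ T (r - s) = 0 := by
      refine setIntegral_eq_zero_of_forall_eq_zero fun r hr => ?_
      exact rlKernel_of_nonpos θ T (by linarith [hr.2])
    rw [this, mul_zero]

/-- The Riemann–Liouville integral of order greater than one is continuous. -/
lemma continuousOn_fracIntegral_add_one {θ T : ℝ} (hθ : 0 < θ) (hT : 0 < T) {w : ℝ → ℝ}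
    (hw : Integrable w (timeMeasure T)) : ContinuousOn (fracIntegral (θ + 1) w) (Icc 0 T) := by
  have h := intervalIntegrable_of_integrable_timeMeasure hT (integrable_fracIntegral hθ hT hw)
  have h2 : ContinuousOn (fun t => ∫ r in (0 : ℝ)..t, fracIntegral θ w r) (Icc 0 T) := by
    have := h.absolutelyContinuousOnInterval_intervalIntegral (c := 0) (by simp)
    have := this.continuousOn
    rwa [uIcc_of_le hT.le] at this
  exact h2.congr fun t ht => fracIntegral_add_one hθ hT hw ht

lemma fracIntegral_zero (γ : ℝ) (w : ℝ → ℝ) : fracIntegral γ w 0 = 0 := by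
  simp [fracIntegral]

lemma integrable_of_memLp_two {T : ℝ} {w : ℝ → ℝ} (hw : MemLp w 2 (timeMeasure T)) :
    Integrable w (timeMeasure T) := by
  have : IsFiniteMeasure (timeMeasure T) := by unfold timeMeasure; infer_instance
  exact hw.integrable (by norm_num)

section Fourier
open FourierTransform

/-- `w`, extended by `0` outside `(0,T)`, as a complex-valued function on the line. -/
noncomputable def complexExtension (T : ℝ) (w : ℝ → ℝ) (t : ℝ) : ℂ :=
  ((Ioo 0 T).indicator w t : ℝ)

lemma integrable_complexExtension {T : ℝ} {w : ℝ → ℝ} (hw : Integrable w (timeMeasure T)) :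
    Integrable (complexExtension T w) := by
  have hW : Integrable ((Ioo 0 T).indicator w) := IntegrableOn.integrable_indicator hw
    measurableSet_Ioo
  exact hW.ofReal

lemma eLpNorm_complexExtension (T : ℝ) (w : ℝ → ℝ) :
    eLpNorm (complexExtension T w) 2 = eLpNorm w 2 (timeMeasure T) := by
  rw [timeMeasure, ← eLpNorm_indicator_eq_eLpNorm_restrict measurableSet_Ioo]
  refine eLpNorm_congr_norm_ae (Filter.Eventually.of_forall fun t => ?_)
  rw [complexExtension, Complex.norm_real]

lemma memLp_complexExtension {T : ℝ} {w : ℝ → ℝ} (hw : MemLp w 2 (timeMeasure T)) :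
    MemLp (complexExtension T w) 2 :=
  ⟨(integrable_complexExtension (integrable_of_memLp_two hw)).1, by
    rw [eLpNorm_complexExtension]; exact hw.2⟩

lemma norm_fourier_rlConv {θ T : ℝ} (hθ : 0 < θ) (hT : 0 < T) {w : ℝ → ℝ}
    (hw : Integrable w (timeMeasure T)) (ξ : ℝ) :
    ‖𝓕 (fun t => (rlConv θ T w t : ℂ)) ξ‖
      = ‖𝓕 (fun t => (rlKernel θ T t : ℂ)) ξ‖ * ‖𝓕 (complexExtension T w) ξ‖ := by
  have hk : Integrable fun t => (rlKernel θ T t : ℂ) := (integrable_rlKernel hθ hT).ofReal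
  have h := Real.fourier_mul_convolution_eq (integrable_complexExtension hw) hk ξ
  have h2 : (fun t => (rlConv θ T w t : ℂ))
      = convolution (complexExtension T w) (fun t => (rlKernel θ T t : ℂ))
        (ContinuousLinearMap.mul ℂ ℂ) volume := by
    ext t
    rw [rlConv, ← integral_complex_ofReal, convolution_def]
    simp [complexExtension]
  rw [h2, h, norm_mul, mul_comm]

lemma norm_fourier_rlConv_le {θ T : ℝ} (hθ : 0 < θ) (hT : 0 < T) {w : ℝ → ℝ}
    (hw : Integrable w (timeMeasure T)) (ξ : ℝ) :
    ‖𝓕 (fun t => (rlConv θ T w t : ℂ)) ξ‖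
      ≤ (∫ t, rlKernel θ T t) * ‖𝓕 (complexExtension T w) ξ‖ := by
  rw [norm_fourier_rlConv hθ hT hw]
  gcongr
  refine (norm_fourier_le ξ).trans (le_of_eq ?_)
  congr 1 with t
  rw [Complex.norm_real, Real.norm_of_nonneg (rlKernel_nonneg hθ T t)]

lemma norm_fourier_rlConv_le_rpow {θ T : ℝ} (hθ : 0 < θ) (hθ1 : θ ≤ 1) (hT : 0 < T) {w : ℝ → ℝ}
    (hw : Integrable w (timeMeasure T)) {ξ : ℝ} (hξ : ξ ≠ 0) :
    ‖𝓕 (fun t => (rlConv θ T w t : ℂ)) ξ‖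
      ≤ 1 / Real.Gamma (θ + 1) * |ξ| ^ (-θ) * ‖𝓕 (complexExtension T w) ξ‖ := by
  rw [norm_fourier_rlConv hθ hT hw]
  have hp : 0 < |ξ| := abs_pos.2 hξ
  have hΓ : 0 < Real.Gamma (θ + 1) := Real.Gamma_pos_of_pos (by linarith)
  gcongr
  refine (norm_fourier_le_of_antitoneOn (integrable_rlKernel hθ hT) (rlKernel_nonneg hθ T)
    (fun t ht => rlKernel_of_nonpos θ T ht) (antitoneOn_rlKernel hθ hθ1 T) hξ).trans ?_
  refine (setIntegral_rlKernel_le hθ hT (by positivity)).trans ?_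
  rw [one_div_mul_eq_div, Real.rpow_neg hp.le, ← Real.inv_rpow hp.le]
  gcongr
  rw [one_div]
  exact inv_anti₀ hp (by linarith)

/-- The whole-line Gagliardo estimate for `J^θ w`. -/
lemma lintegral_gagliardo_rlConv_le {θ T : ℝ} (hθ : 0 < θ) (hθ1 : θ < 1) (hT : 0 < T) {w : ℝ → ℝ}
    (hw : MemLp w 2 (timeMeasure T)) :
    ∫⁻ t, ∫⁻ s, ‖rlConv θ T w t - rlConv θ T w s‖ₑ ^ 2 / ENNReal.ofReal (|t - s| ^ (1 + 2 * θ))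
      ≤ ENNReal.ofReal ((1 / Real.Gamma (θ + 1)) ^ 2) * gagliardoConst θ
        * eLpNorm w 2 (timeMeasure T) ^ 2 := by
  have hwi := integrable_of_memLp_two hw
  have hf : Integrable fun t => (rlConv θ T w t : ℂ) := (integrable_rlConv hθ hT hwi).ofReal
  have h := lintegral_gagliardo_le hf (integrable_complexExtension hwi)
    (memLp_complexExtension hw) (norm_fourier_rlConv_le hθ hT hwi)
    (fun ξ hξ => norm_fourier_rlConv_le_rpow hθ hθ1.le hT hwi hξ)
  rw [← lintegral_lintegral_gagliardo_eq hf.1, eLpNorm_complexExtension] at h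
  refine le_trans (le_of_eq ?_) h
  refine lintegral_congr fun t => lintegral_congr fun s => ?_
  rw [← Complex.ofReal_sub, ← ofReal_norm, ← ofReal_norm, Complex.norm_real]

end Fourier

lemma eLpNorm_fracIntegral_le {θ T : ℝ} (hθ : 0 < θ) (hT : 0 < T) {w : ℝ → ℝ}
    (hw : MemLp w 2 (timeMeasure T)) :
    eLpNorm (fracIntegral θ w) 2 (timeMeasure T)
      ≤ ENNReal.ofReal (∫ t, rlKernel θ T t) * eLpNorm w 2 (timeMeasure T) := by
  have hwi := integrable_of_memLp_two hw
  have hf : Integrable fun t => (rlConv θ T w t : ℂ) := (integrable_rlConv hθ hT hwi).ofReal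
  have h := eLpNorm_le_of_fourier_le hf (integrable_complexExtension hwi)
    (memLp_complexExtension hw) (norm_fourier_rlConv_le hθ hT hwi)
  rw [eLpNorm_complexExtension] at h
  refine le_trans ?_ h
  rw [eLpNorm_congr_ae (fracIntegral_ae_eq_rlConv θ T w)]
  refine (eLpNorm_mono_measure _ Measure.restrict_le_self).trans (le_of_eq ?_)
  refine eLpNorm_congr_norm_ae (Filter.Eventually.of_forall fun t => ?_)
  rw [Complex.norm_real]

lemma memLp_fracIntegral {θ T : ℝ} (hθ : 0 < θ) (hT : 0 < T) {w : ℝ → ℝ}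
    (hw : MemLp w 2 (timeMeasure T)) : MemLp (fracIntegral θ w) 2 (timeMeasure T) :=
  ⟨(integrable_fracIntegral hθ hT (integrable_of_memLp_two hw)).1,
    (eLpNorm_fracIntegral_le hθ hT hw).trans_lt (ENNReal.mul_lt_top ENNReal.ofReal_lt_top hw.2)⟩

lemma slobodeckijSq_fracIntegral_le {θ T : ℝ} (hθ : 0 < θ) (hθ1 : θ < 1) (hT : 0 < T) {w : ℝ → ℝ}
    (hw : MemLp w 2 (timeMeasure T)) :
    slobodeckijSq T θ (fracIntegral θ w)
      ≤ ENNReal.ofReal ((1 / Real.Gamma (θ + 1)) ^ 2) * gagliardoConst θ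
        * eLpNorm w 2 (timeMeasure T) ^ 2 := by
  refine le_trans ?_ (lintegral_gagliardo_rlConv_le hθ hθ1 hT hw)
  calc slobodeckijSq T θ (fracIntegral θ w)
      = ∫⁻ t in Ioo 0 T, ∫⁻ s in Ioo 0 T,
          ‖rlConv θ T w t - rlConv θ T w s‖ₑ ^ 2 / ENNReal.ofReal (|t - s| ^ (1 + 2 * θ)) := by
        refine setLIntegral_congr_fun measurableSet_Ioo fun t ht => ?_
        refine setLIntegral_congr_fun measurableSet_Ioo fun s hs => ?_
        simp only [rlConv_eq_fracIntegral θ w ht, rlConv_eq_fracIntegral θ w hs]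
    _ ≤ ∫⁻ t in Ioo 0 T, ∫⁻ s,
          ‖rlConv θ T w t - rlConv θ T w s‖ₑ ^ 2 / ENNReal.ofReal (|t - s| ^ (1 + 2 * θ)) :=
        lintegral_mono fun t => setLIntegral_le_lintegral _ _
    _ ≤ _ := setLIntegral_le_lintegral _ _

lemma lintegral_Iio_inv_sq {t : ℝ} (ht : 0 < t) :
    ∫⁻ s in Iio (0 : ℝ), (ENNReal.ofReal (|t - s| ^ (2 : ℝ)))⁻¹ = (ENNReal.ofReal t)⁻¹ := by
  have h1 : ∫⁻ s in Iio (0 : ℝ), (ENNReal.ofReal (|t - s| ^ (2 : ℝ)))⁻¹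
      = ∫⁻ x in Ioi t, ENNReal.ofReal (x ^ (-2 : ℝ)) := by
    rw [← lintegral_indicator measurableSet_Iio, ← lintegral_indicator measurableSet_Ioi,
      ← lintegral_sub_left_eq_self _ t]
    refine lintegral_congr fun x => ?_
    by_cases hx : t < x
    · have hx0 : 0 < x := ht.trans hx
      rw [indicator_of_mem (show t - x ∈ Iio (0 : ℝ) from sub_neg.2 hx),
        indicator_of_mem (show x ∈ Ioi t from hx), sub_sub_cancel, abs_of_pos hx0,
        Real.rpow_neg hx0.le, ENNReal.ofReal_inv_of_pos (by positivity)]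
    · rw [indicator_of_notMem (fun h : t - x ∈ Iio 0 => hx (sub_neg.1 h)),
        indicator_of_notMem (fun h : x ∈ Ioi t => hx h)]
  rw [h1, ← ofReal_integral_eq_lintegral_ofReal
    (integrableOn_Ioi_rpow_of_lt (by norm_num) ht)
    ((ae_restrict_iff' measurableSet_Ioi).2 (Filter.Eventually.of_forall fun x hx =>
      Real.rpow_nonneg (ht.trans hx).le _)), integral_Ioi_rpow_of_lt (by norm_num) ht,
    ← ENNReal.ofReal_inv_of_pos ht]
  norm_num
  rw [Real.rpow_neg_one]

/-- At `θ = 1/2` the weighted integral is the part of the whole-line Gagliardo integral over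
`t > 0 > s`, where the extension by zero gives `f t - f s = f t`. -/
lemma weightedSq_fracIntegral_half_le {T : ℝ} (hT : 0 < T) {w : ℝ → ℝ}
    (hw : MemLp w 2 (timeMeasure T)) :
    weightedSq T (fracIntegral (1 / 2) w)
      ≤ ENNReal.ofReal ((1 / Real.Gamma (1 / 2 + 1)) ^ 2) * gagliardoConst (1 / 2)
        * eLpNorm w 2 (timeMeasure T) ^ 2 := by
  refine le_trans ?_ (lintegral_gagliardo_rlConv_le (by norm_num) (by norm_num) hT hw)
  refine le_trans ?_ (setLIntegral_le_lintegral (Ioo 0 T) _)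
  refine setLIntegral_mono' measurableSet_Ioo fun t ht => ?_
  refine le_trans ?_ (setLIntegral_le_lintegral (Iio 0) _)
  rw [div_eq_mul_inv, ← lintegral_Iio_inv_sq ht.1, ← lintegral_const_mul _ (by fun_prop)]
  refine setLIntegral_mono' measurableSet_Iio fun s hs => le_of_eq ?_
  rw [rlConv_eq_fracIntegral _ w ht, rlConv_of_nonpos _ _ _ (le_of_lt hs), sub_zero,
    show (1 : ℝ) + 2 * (1 / 2) = 2 by norm_num]
  exact (div_eq_mul_inv _ _).symm

/-! ### Vanishing at zero for `θ > 1/2` -/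

section Fourier
open FourierTransform SchwartzMap

lemma integral_schwartz_smul_fourierInv {G : ℝ → ℂ} (hG : Integrable G) (φ : 𝓢(ℝ, ℂ)) :
    ∫ x, (𝓕⁻ φ) x • G x = ∫ x, φ x • 𝓕⁻ G x := by
  have := VectorFourier.integral_fourierIntegral_smul_eq_flip (e := Real.fourierChar)
    (μ := volume) (ν := volume) (L := -innerₗ ℝ) (f := φ) (g := G) Real.continuous_fourierChar
    (by exact continuous_inner.neg) φ.integrable hG
  rw [show (-innerₗ ℝ : ℝ →ₗ[ℝ] ℝ →ₗ[ℝ] ℝ).flip = -innerₗ ℝ by ext; simp] at this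
  simp only [fourierInv_coe]
  exact this

lemma continuous_fourierInv {G : ℝ → ℂ} (hG : Integrable G) : Continuous (𝓕⁻ G) :=
  VectorFourier.fourierIntegral_continuous Real.continuous_fourierChar
    (by exact continuous_inner.neg) hG

/-- Fourier inversion almost everywhere, without a continuity assumption on `G`. -/
lemma fourierInv_fourier_ae_eq {G : ℝ → ℂ} (hG : Integrable G) (hFG : Integrable (𝓕 G)) :
    G =ᵐ[volume] 𝓕⁻ (𝓕 G) := by
  refine ae_eq_of_forall_integral_schwartz_smul hG.locallyIntegrable
    (continuous_fourierInv hFG).locallyIntegrable fun φ => ?_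
  rw [← integral_schwartz_smul_fourierInv hFG, ← integral_schwartz_smul_fourier hG,
    fourier_fourierInv_eq]

lemma memLp_rlKernel_two {θ T : ℝ} (hθ : 1 / 2 < θ) (hT : 0 < T) : MemLp (rlKernel θ T) 2 := by
  have hθ0 : 0 < θ := by linarith
  refine (memLp_two_iff_integrable_sq (integrable_rlKernel hθ0 hT).1).2 ?_
  have h : IntegrableOn (fun t : ℝ => t ^ (2 * θ - 2) / Real.Gamma θ ^ 2) (Ioo 0 T) := by
    refine Integrable.div_const ?_ _
    rw [← IntegrableOn, ← intervalIntegrable_iff_integrableOn_Ioo_of_le hT.le]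
    exact intervalIntegral.intervalIntegrable_rpow' (by linarith)
  refine (h.integrable_indicator measurableSet_Ioo).congr (Filter.Eventually.of_forall fun t => ?_)
  by_cases ht : t ∈ Ioo 0 T
  · simp only [rlKernel, indicator_of_mem ht]
    rw [div_pow, ← Real.rpow_natCast (t ^ (θ - 1)) 2, ← Real.rpow_mul ht.1.le]
    congr 2
    push_cast
    ring
  · simp [rlKernel, indicator_of_notMem ht]

/-- For `θ > 1/2` the kernel is square integrable, so that the Fourier transform of `J^θ w` is
integrable; the continuous representative vanishes on `(-∞, 0)`, hence at `0`. -/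
lemma vanishesAtZero_fracIntegral_of_half_lt {θ T : ℝ} (hθ : 1 / 2 < θ) (hT : 0 < T) {w : ℝ → ℝ}
    (hw : MemLp w 2 (timeMeasure T)) : VanishesAtZero T (fracIntegral θ w) := by
  have hθ0 : 0 < θ := by linarith
  have hwi := integrable_of_memLp_two hw
  set f : ℝ → ℂ := fun t => (rlConv θ T w t : ℂ) with hfdef
  have hf : Integrable f := (integrable_rlConv hθ0 hT hwi).ofReal
  have hk : Integrable fun t => (rlKernel θ T t : ℂ) := (integrable_rlKernel hθ0 hT).ofReal
  have hk2 : MemLp (fun t => (rlKernel θ T t : ℂ)) 2 := (memLp_rlKernel_two hθ hT).ofReal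
  have hFk : MemLp (𝓕 fun t => (rlKernel θ T t : ℂ)) 2 := by
    refine ⟨(continuous_fourier hk).aestronglyMeasurable, ?_⟩
    rw [eLpNorm_fourier_of_memLp hk hk2]
    exact hk2.2
  have hFW : MemLp (𝓕 (complexExtension T w)) 2 := by
    refine ⟨(continuous_fourier (integrable_complexExtension hwi)).aestronglyMeasurable, ?_⟩
    rw [eLpNorm_fourier_of_memLp (integrable_complexExtension hwi) (memLp_complexExtension hw)]
    exact (memLp_complexExtension hw).2
  have hFf : Integrable (𝓕 f) := by
    refine (hFk.integrable_mul hFW).mono (continuous_fourier hf).aestronglyMeasurable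
      (Filter.Eventually.of_forall fun ξ => le_of_eq ?_)
    rw [norm_fourier_rlConv hθ0 hT hwi, Pi.mul_apply, norm_mul]
  have hae := fourierInv_fourier_ae_eq hf hFf
  have hcont := continuous_fourierInv hFf
  refine ⟨fun t => (𝓕⁻ (𝓕 f) t).re, (Complex.continuous_re.comp hcont).continuousOn, ?_, ?_⟩
  · filter_upwards [fracIntegral_ae_eq_rlConv θ T w, ae_restrict_of_ae hae] with t h1 h2
    rw [h1, ← h2]
    simp [hfdef]
  · have hz : (Iio (0 : ℝ)).EqOn (𝓕⁻ (𝓕 f)) 0 := by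
      refine Measure.eqOn_open_of_ae_eq (μ := volume) ?_ isOpen_Iio hcont.continuousOn
        continuousOn_const
      refine (ae_restrict_iff' measurableSet_Iio).2 (hae.mono fun t ht htm => ?_)
      rw [← ht, hfdef]
      simp [rlConv_of_nonpos θ T w (le_of_lt htm)]
    have h0 : 𝓕⁻ (𝓕 f) 0 = 0 :=
      hz.closure hcont continuous_const (by rw [closure_Iio]; exact self_mem_Iic)
    simp [h0]

end Fourier

/-! ### The spaces `H_α` and `H^α` -/

lemma setLIntegral_congr_ae_timeMeasure {T : ℝ} {A B : ℝ → ℝ≥0∞} (h : A =ᵐ[timeMeasure T] B) :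
    ∫⁻ t in Ioo 0 T, A t = ∫⁻ t in Ioo 0 T, B t :=
  lintegral_congr_ae h

lemma slobodeckijSq_congr {T : ℝ} (θ : ℝ) {f g : ℝ → ℝ} (h : f =ᵐ[timeMeasure T] g) :
    slobodeckijSq T θ f = slobodeckijSq T θ g := by
  refine setLIntegral_congr_ae_timeMeasure ?_
  filter_upwards [h] with t ht
  refine setLIntegral_congr_ae_timeMeasure ?_
  filter_upwards [h] with s hs
  rw [ht, hs]

lemma weightedSq_congr {T : ℝ} {f g : ℝ → ℝ} (h : f =ᵐ[timeMeasure T] g) :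
    weightedSq T f = weightedSq T g := by
  refine setLIntegral_congr_ae_timeMeasure ?_
  filter_upwards [h] with t ht
  rw [ht]

lemma slobodeckijSq_const_add (T θ c : ℝ) (f : ℝ → ℝ) :
    slobodeckijSq T θ (fun t => c + f t) = slobodeckijSq T θ f := by
  simp only [slobodeckijSq, add_sub_add_left_eq_sub]

lemma VanishesAtZero.congr {T : ℝ} {f g : ℝ → ℝ} (hf : VanishesAtZero T f)
    (h : g =ᵐ[timeMeasure T] f) : VanishesAtZero T g := by
  obtain ⟨k, hk, hfk, h0⟩ := hf
  exact ⟨k, hk, h.trans hfk, h0⟩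

lemma vanishesAtZero_fracIntegral_add_one {θ T : ℝ} (hθ : 0 < θ) (hT : 0 < T) {w : ℝ → ℝ}
    (hw : Integrable w (timeMeasure T)) : VanishesAtZero T (fracIntegral (θ + 1) w) :=
  ⟨_, continuousOn_fracIntegral_add_one hθ hT hw, ae_eq_refl _, fracIntegral_zero _ _⟩

lemma fracIntegral_one (w : ℝ → ℝ) (t : ℝ) : fracIntegral 1 w t = ∫ s in (0 : ℝ)..t, w s := by
  simp [fracIntegral]

lemma vanishesAtZero_primitive {T : ℝ} (hT : 0 < T) {w : ℝ → ℝ}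
    (hw : Integrable w (timeMeasure T)) : VanishesAtZero T (fracIntegral 1 w) := by
  refine ⟨fun t => ∫ s in (0 : ℝ)..t, w s, ?_, ?_, by simp⟩
  · have := (intervalIntegrable_of_integrable_timeMeasure hT
      hw).absolutelyContinuousOnInterval_intervalIntegral (c := 0) (by simp)
    have := this.continuousOn
    rwa [uIcc_of_le hT.le] at this
  · exact Filter.Eventually.of_forall fun t => fracIntegral_one w t

/-- The affine perturbation `c₀ + c₁ t + J^{θ+1} w` has the weak derivative `c₁ + J^θ w`. -/
lemma hasWeakDeriv_affine_add_fracIntegral {θ T : ℝ} (hθ : 0 < θ) (hT : 0 < T) {w f : ℝ → ℝ}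
    (hw : Integrable w (timeMeasure T)) {c₀ c₁ : ℝ}
    (hf : f =ᵐ[timeMeasure T] fun t => c₀ + c₁ * t + fracIntegral (θ + 1) w t) :
    HasWeakDeriv T f (fun t => c₁ + fracIntegral θ w t) := by
  have : IsFiniteMeasure (timeMeasure T) := by unfold timeMeasure; infer_instance
  have hi := integrable_fracIntegral hθ hT hw
  refine hasWeakDeriv_of_ae_eq_primitive hT (c := c₀) ((integrable_const c₁).add hi) ?_
  filter_upwards [hf, ae_restrict_mem measurableSet_Ioo] with t ht htm
  have hii : IntervalIntegrable (fracIntegral θ w) volume 0 t :=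
    (intervalIntegrable_of_integrable_timeMeasure hT hi).mono_set (by
      rw [uIcc_of_le hT.le, uIcc_of_le htm.1.le]; exact Icc_subset_Icc_right htm.2.le)
  rw [ht, intervalIntegral.integral_add (by simp) hii,
    fracIntegral_add_one hθ hT hw ⟨htm.1.le, htm.2.le⟩]
  simp
  ring

/-- `w` is the weak derivative of `c₁ + J^1 w`. -/
lemma hasWeakDeriv_const_add_primitive {T : ℝ} (hT : 0 < T) {w f : ℝ → ℝ}
    (hw : Integrable w (timeMeasure T)) {c : ℝ}
    (hf : f =ᵐ[timeMeasure T] fun t => c + fracIntegral 1 w t) : HasWeakDeriv T f w := by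
  refine hasWeakDeriv_of_ae_eq_primitive hT (c := c) hw ?_
  filter_upwards [hf] with t ht
  rw [ht, fracIntegral_one]

lemma memLp_const_timeMeasure (T c : ℝ) : MemLp (fun _ => c) 2 (timeMeasure T) := by
  have : IsFiniteMeasure (timeMeasure T) := by unfold timeMeasure; infer_instance
  exact memLp_const c

lemma memLp_id_timeMeasure (T : ℝ) : MemLp (fun t : ℝ => t) 2 (timeMeasure T) := by
  have : IsFiniteMeasure (timeMeasure T) := by unfold timeMeasure; infer_instance
  refine MemLp.of_bound (by fun_prop) T ?_
  refine (ae_restrict_iff' measurableSet_Ioo).2 (Filter.Eventually.of_forall fun t ht => ?_)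
  rw [Real.norm_of_nonneg ht.1.le]
  exact ht.2.le

lemma eLpNorm_const_timeMeasure (T c : ℝ) :
    eLpNorm (fun _ => c) 2 (timeMeasure T) = ‖c‖ₑ * eLpNorm (fun _ => (1 : ℝ)) 2 (timeMeasure T) := by
  have := eLpNorm_const_smul c (fun _ : ℝ => (1 : ℝ)) 2 (timeMeasure T)
  simpa [Pi.smul_def] using this

lemma eLpNorm_const_mul_id_timeMeasure (T c : ℝ) : eLpNorm (fun t => c * t) 2 (timeMeasure T)
      = ‖c‖ₑ * eLpNorm (fun t : ℝ => t) 2 (timeMeasure T) := by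
  rw [← eLpNorm_const_smul]
  rfl

/-- The size of the data of `c₀ + c₁ t + J^α w`. -/
noncomputable def dataNorm (T c₀ c₁ : ℝ) (w : ℝ → ℝ) : ℝ≥0∞ :=
  ‖c₀‖ₑ + ‖c₁‖ₑ + eLpNorm w 2 (timeMeasure T)

lemma exists_eLpNorm_const_add_fracIntegral_le {θ T : ℝ} (hθ : 0 < θ) (hT : 0 < T) :
    ∃ K : ℝ≥0∞, K ≠ ⊤ ∧ ∀ (w : ℝ → ℝ) (c₀ c₁ : ℝ), MemLp w 2 (timeMeasure T) →
      eLpNorm (fun t => c₁ + fracIntegral θ w t) 2 (timeMeasure T) ≤ K * dataNorm T c₀ c₁ w := by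
  set k1 := eLpNorm (fun _ => (1 : ℝ)) 2 (timeMeasure T)
  refine ⟨k1 + ENNReal.ofReal (∫ t, rlKernel θ T t),
    ENNReal.add_ne_top.2 ⟨(memLp_const_timeMeasure T 1).2.ne, ENNReal.ofReal_ne_top⟩,
    fun w c₀ c₁ hw => ?_⟩
  refine (eLpNorm_add_le (memLp_const_timeMeasure T c₁).1 (memLp_fracIntegral hθ hT hw).1
    one_le_two).trans ?_
  rw [eLpNorm_const_timeMeasure, add_mul, mul_comm _ k1]
  refine add_le_add (mul_le_mul_right (le_add_right le_add_self) _)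
    ((eLpNorm_fracIntegral_le hθ hT hw).trans (mul_le_mul_right le_add_self _))

lemma exists_eLpNorm_affine_add_fracIntegral_le {θ T : ℝ} (hθ : 0 < θ) (hT : 0 < T) :
    ∃ K : ℝ≥0∞, K ≠ ⊤ ∧ ∀ (w : ℝ → ℝ) (c₀ c₁ : ℝ), MemLp w 2 (timeMeasure T) →
      eLpNorm (fun t => c₀ + c₁ * t + fracIntegral θ w t) 2 (timeMeasure T)
        ≤ K * dataNorm T c₀ c₁ w := by
  set k1 := eLpNorm (fun _ => (1 : ℝ)) 2 (timeMeasure T)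
  set k2 := eLpNorm (fun t : ℝ => t) 2 (timeMeasure T)
  refine ⟨k1 + k2 + ENNReal.ofReal (∫ t, rlKernel θ T t),
    ENNReal.add_ne_top.2 ⟨ENNReal.add_ne_top.2 ⟨(memLp_const_timeMeasure T 1).2.ne,
      (memLp_id_timeMeasure T).2.ne⟩, ENNReal.ofReal_ne_top⟩, fun w c₀ c₁ hw => ?_⟩
  have h0 := (memLp_const_timeMeasure T c₀).1
  have h1 := ((memLp_id_timeMeasure T).const_mul c₁).1
  refine (eLpNorm_add_le (h0.add h1) (memLp_fracIntegral hθ hT hw).1 one_le_two).trans ?_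
  rw [add_mul, add_mul]
  refine add_le_add ((eLpNorm_add_le h0 h1 one_le_two).trans ?_)
    ((eLpNorm_fracIntegral_le hθ hT hw).trans (mul_le_mul_right le_add_self _))
  rw [eLpNorm_const_timeMeasure, eLpNorm_const_mul_id_timeMeasure, mul_comm _ k1, mul_comm _ k2]
  exact add_le_add (mul_le_mul_right (le_add_right le_self_add) _)
    (mul_le_mul_right (le_add_right le_add_self) _)

lemma floor_eq_one {α : ℝ} (h1 : 1 < α) (h2 : α < 2) : ⌊α⌋₊ = 1 := by
  rw [Nat.floor_eq_iff (by linarith)]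
  norm_num
  exact ⟨h1.le, h2⟩

lemma floor_two : ⌊(2 : ℝ)⌋₊ = 2 := Nat.floor_ofNat 2

lemma eLpNorm_sq_le {T : ℝ} {f : ℝ → ℝ} {K X : ℝ≥0∞} (h : eLpNorm f 2 (timeMeasure T) ≤ K * X) :
    eLpNorm f 2 (timeMeasure T) ^ 2 ≤ K ^ 2 * X ^ 2 := by
  rw [← mul_pow]
  exact pow_le_pow_left₀ zero_le h 2

/-- `c₀ + c₁ t + J^α w` is in `H^α(0,T)`, with a bound for all terms of the norm. -/
lemma exists_memH_and_normSq_le {α T : ℝ} (h1 : 1 < α) (h2 : α ≤ 2) (hT : 0 < T) :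
    ∃ K : ℝ≥0∞, K ≠ ⊤ ∧ ∀ (w f : ℝ → ℝ) (c₀ c₁ : ℝ), MemLp w 2 (timeMeasure T) →
      (f =ᵐ[timeMeasure T] fun t => c₀ + c₁ * t + fracIntegral α w t) →
      MemH T α f ∧ hNatNormSq T ⌊α⌋₊ f + hFracNormSq T (α - ⌊α⌋₊) (iterWeakDeriv T ⌊α⌋₊ f)
        ≤ K * dataNorm T c₀ c₁ w ^ 2 := by
  obtain ⟨θ, rfl⟩ : ∃ θ, α = θ + 1 := ⟨α - 1, by ring⟩
  have hθ : 0 < θ := by linarith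
  obtain ⟨K0, hK0, hb0⟩ := exists_eLpNorm_affine_add_fracIntegral_le (θ := θ + 1) (by linarith) hT
  obtain ⟨K1, hK1, hb1⟩ := exists_eLpNorm_const_add_fracIntegral_le hθ hT
  have hLp0 : ∀ (w : ℝ → ℝ) (c₀ c₁ : ℝ), MemLp w 2 (timeMeasure T) →
      MemLp (fun t => c₀ + c₁ * t + fracIntegral (θ + 1) w t) 2 (timeMeasure T) :=
    fun w c₀ c₁ hw => ((memLp_const_timeMeasure T c₀).add
      ((memLp_id_timeMeasure T).const_mul c₁)).add (memLp_fracIntegral (by linarith) hT hw)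
  have hLp1 : ∀ (w : ℝ → ℝ) (c₁ : ℝ), MemLp w 2 (timeMeasure T) →
      MemLp (fun t => c₁ + fracIntegral θ w t) 2 (timeMeasure T) :=
    fun w c₁ hw => (memLp_const_timeMeasure T c₁).add (memLp_fracIntegral hθ hT hw)
  rcases h2.lt_or_eq with h2 | h2
  · have hθ1 : θ < 1 := by linarith
    rw [floor_eq_one h1 h2, Nat.cast_one, add_sub_cancel_right]
    set K2 := ENNReal.ofReal ((1 / Real.Gamma (θ + 1)) ^ 2) * gagliardoConst θ with hK2
    have hK2t : K2 ≠ ⊤ := ENNReal.mul_ne_top ENNReal.ofReal_ne_top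
      (gagliardoConst_lt_top hθ hθ1).ne
    -- The norm of the derivative occurs twice: in the `H^1` norm and in the `H^θ` norm.
    refine ⟨K0 ^ 2 + K1 ^ 2 + (K1 ^ 2 + K2), by finiteness, fun w f c₀ c₁ hw hf => ?_⟩
    have hd := hasWeakDeriv_affine_add_fracIntegral hθ hT (integrable_of_memLp_two hw) hf
    have hg := hd.weakDeriv_ae_eq
    have hsl : slobodeckijSq T θ (weakDeriv T f) ≤ K2 * dataNorm T c₀ c₁ w ^ 2 := by
      rw [slobodeckijSq_congr θ hg, slobodeckijSq_const_add]
      refine (slobodeckijSq_fracIntegral_le hθ hθ1 hT hw).trans ?_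
      exact mul_le_mul_right (pow_le_pow_left₀ zero_le le_add_self 2) _
    have hn0 : eLpNorm f 2 (timeMeasure T) ^ 2 ≤ K0 ^ 2 * dataNorm T c₀ c₁ w ^ 2 :=
      eLpNorm_sq_le (by rw [eLpNorm_congr_ae hf]; exact hb0 w c₀ c₁ hw)
    have hn1 : eLpNorm (weakDeriv T f) 2 (timeMeasure T) ^ 2
        ≤ K1 ^ 2 * dataNorm T c₀ c₁ w ^ 2 :=
      eLpNorm_sq_le (by rw [eLpNorm_congr_ae hg]; exact hb1 w c₀ c₁ hw)
    have hm0 : MemLp f 2 (timeMeasure T) := (memLp_congr_ae hf).2 (hLp0 w c₀ c₁ hw)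
    have hm1 : MemLp (weakDeriv T f) 2 (timeMeasure T) := (memLp_congr_ae hg).2 (hLp1 w c₁ hw)
    refine ⟨?_, ?_⟩
    · rw [MemH, floor_eq_one h1 h2, Nat.cast_one, add_sub_cancel_right]
      refine ⟨⟨fun k hk => ?_, fun k hk => ?_⟩, hm1, fun _ => ?_⟩
      · obtain rfl : k = 0 := by omega
        exact hd.hasWeakDeriv_weakDeriv
      · interval_cases k
        · exact hm0
        · exact hm1
      · exact lt_of_eq_of_lt ((slobodeckijSq_congr θ hg).trans (slobodeckijSq_const_add T θ c₁ _))
          ((slobodeckijSq_fracIntegral_le hθ hθ1 hT hw).trans_lt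
            (ENNReal.mul_lt_top hK2t.lt_top (ENNReal.pow_lt_top hw.2)))
    · rw [hNatNormSq, hFracNormSq, if_neg hθ.ne', Finset.sum_range_succ, Finset.sum_range_one]
      simp only [add_mul]
      exact add_le_add (add_le_add hn0 hn1) (add_le_add hn1 hsl)
  · obtain rfl : θ = 1 := by linarith
    rw [show (1 : ℝ) + 1 = 2 by norm_num] at *
    rw [floor_two, Nat.cast_ofNat, sub_self]
    refine ⟨K0 ^ 2 + K1 ^ 2 + 1 + 1, by finiteness, fun w f c₀ c₁ hw hf => ?_⟩
    have hwi := integrable_of_memLp_two hw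
    have hd := hasWeakDeriv_affine_add_fracIntegral (f := f) (c₀ := c₀) (c₁ := c₁) hθ hT hwi
      (by rw [show (1 : ℝ) + 1 = 2 by norm_num]; exact hf)
    have hg := hd.weakDeriv_ae_eq
    have hd2 := hasWeakDeriv_const_add_primitive hT hwi hg
    have hg2 := hd2.weakDeriv_ae_eq
    have hn0 : eLpNorm f 2 (timeMeasure T) ^ 2 ≤ K0 ^ 2 * dataNorm T c₀ c₁ w ^ 2 :=
      eLpNorm_sq_le (by rw [eLpNorm_congr_ae hf]; exact hb0 w c₀ c₁ hw)
    have hn1 : eLpNorm (weakDeriv T f) 2 (timeMeasure T) ^ 2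
        ≤ K1 ^ 2 * dataNorm T c₀ c₁ w ^ 2 :=
      eLpNorm_sq_le (by rw [eLpNorm_congr_ae hg]; exact hb1 w c₀ c₁ hw)
    have hn2 : eLpNorm (weakDeriv T (weakDeriv T f)) 2 (timeMeasure T) ^ 2
        ≤ 1 * dataNorm T c₀ c₁ w ^ 2 := by
      rw [one_mul, eLpNorm_congr_ae hg2]
      exact pow_le_pow_left₀ zero_le le_add_self 2
    have hm0 : MemLp f 2 (timeMeasure T) := (memLp_congr_ae hf).2 (hLp0 w c₀ c₁ hw)
    have hm1 : MemLp (weakDeriv T f) 2 (timeMeasure T) := (memLp_congr_ae hg).2 (hLp1 w c₁ hw)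
    have hm2 : MemLp (weakDeriv T (weakDeriv T f)) 2 (timeMeasure T) := (memLp_congr_ae hg2).2 hw
    refine ⟨?_, ?_⟩
    · rw [MemH, floor_two, Nat.cast_ofNat, sub_self]
      refine ⟨⟨fun k hk => ?_, fun k hk => ?_⟩, hm2, fun h => absurd rfl h⟩
      · interval_cases k
        · exact hd.hasWeakDeriv_weakDeriv
        · exact hd2.hasWeakDeriv_weakDeriv
      · interval_cases k
        · exact hm0
        · exact hm1
        · exact hm2
    · rw [hNatNormSq, hFracNormSq, if_pos rfl, Finset.sum_range_succ, Finset.sum_range_succ,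
        Finset.sum_range_one, add_zero]
      simp only [add_mul]
      exact add_le_add (add_le_add (add_le_add hn0 hn1) hn2) hn2

lemma floor_ne_zero_of_one_lt {α : ℝ} (h1 : 1 < α) : ⌊α⌋₊ ≠ 0 :=
  (Nat.floor_pos.2 h1.le).ne'

/-- For integer `γ` the norm of `H^γ` lacks the second summand, so that only an inequality holds. -/
lemma hNorm_le_normSq_rpow {T α : ℝ} (h1 : 1 < α) (f : ℝ → ℝ) :
    hNorm T α f ≤ (hNatNormSq T ⌊α⌋₊ f
      + hFracNormSq T (α - ⌊α⌋₊) (iterWeakDeriv T ⌊α⌋₊ f)) ^ (1 / 2 : ℝ) := by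
  rw [hNorm, if_neg (floor_ne_zero_of_one_lt h1)]
  refine ENNReal.rpow_le_rpow ?_ (by norm_num)
  split_ifs
  · exact le_self_add
  · exact le_rfl

lemma rpow_half_le_of_le_mul_sq {A K X : ℝ≥0∞} (h : A ≤ K * X ^ 2) :
    A ^ (1 / 2 : ℝ) ≤ K ^ (1 / 2 : ℝ) * X := by
  refine (ENNReal.rpow_le_rpow h (by norm_num)).trans (le_of_eq ?_)
  rw [ENNReal.mul_rpow_of_nonneg _ _ (by norm_num), ← ENNReal.rpow_natCast, ← ENNReal.rpow_mul]
  norm_num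

/-- `c₀ + c₁ t + J^α w` is in `H^α(0,T)`, with a bound by the data. -/
lemma exists_memH_and_hNorm_le {α T : ℝ} (h1 : 1 < α) (h2 : α ≤ 2) (hT : 0 < T) :
    ∃ K : ℝ≥0∞, K ≠ ⊤ ∧ ∀ (w f : ℝ → ℝ) (c₀ c₁ : ℝ), MemLp w 2 (timeMeasure T) →
      (f =ᵐ[timeMeasure T] fun t => c₀ + c₁ * t + fracIntegral α w t) →
      MemH T α f ∧ hNorm T α f ≤ K * dataNorm T c₀ c₁ w := by
  obtain ⟨K, hK, hb⟩ := exists_memH_and_normSq_le h1 h2 hT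
  refine ⟨K ^ (1 / 2 : ℝ), ENNReal.rpow_ne_top_of_nonneg (by norm_num) hK,
    fun w f c₀ c₁ hw hf => ⟨(hb w f c₀ c₁ hw hf).1, ?_⟩⟩
  exact (hNorm_le_normSq_rpow h1 f).trans (rpow_half_le_of_le_mul_sq (hb w f c₀ c₁ hw hf).2)

/-- `J^α` maps `L²(0,T)` boundedly into `H_α(0,T)`. -/
lemma exists_memHSub_and_hSubNorm_le {α T : ℝ} (h1 : 1 < α) (h2 : α ≤ 2) (hT : 0 < T) :
    ∃ K : ℝ≥0∞, K ≠ ⊤ ∧ ∀ (w f : ℝ → ℝ), MemLp w 2 (timeMeasure T) →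
      (f =ᵐ[timeMeasure T] fracIntegral α w) →
      MemHSub T α f ∧ hSubNorm T α f ≤ K * eLpNorm w 2 (timeMeasure T) := by
  obtain ⟨K, hK, hb⟩ := exists_memH_and_normSq_le h1 h2 hT
  set K2 := ENNReal.ofReal ((1 / Real.Gamma (1 / 2 + 1)) ^ 2) * gagliardoConst (1 / 2) with hK2
  have hK2t : K2 ≠ ⊤ := ENNReal.mul_ne_top ENNReal.ofReal_ne_top
    (gagliardoConst_lt_top (by norm_num) (by norm_num)).ne
  refine ⟨(K + K2) ^ (1 / 2 : ℝ), ENNReal.rpow_ne_top_of_nonneg (by norm_num) (by finiteness),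
    fun w f hw hf => ?_⟩
  have hwi := integrable_of_memLp_two hw
  have hf0 : f =ᵐ[timeMeasure T] fun t => 0 + 0 * t + fracIntegral α w t :=
    hf.trans (Filter.Eventually.of_forall fun t => by simp)
  obtain ⟨hmem, hn⟩ := hb w f 0 0 hw hf0
  have hdata : dataNorm T 0 0 w = eLpNorm w 2 (timeMeasure T) := by simp [dataNorm]
  rw [hdata] at hn
  obtain ⟨θ, rfl⟩ : ∃ θ, α = θ + 1 := ⟨α - 1, by ring⟩
  have hθ : 0 < θ := by linarith
  have hv0 : VanishesAtZero T f := (vanishesAtZero_fracIntegral_add_one hθ hT hwi).congr hf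
  have hg : weakDeriv T f =ᵐ[timeMeasure T] fracIntegral θ w :=
    (hasWeakDeriv_affine_add_fracIntegral hθ hT hwi hf0).weakDeriv_ae_eq.trans
      (Filter.Eventually.of_forall fun t => by simp)
  -- The fractional part of `α` can only be `1/2` for `α = 3/2`, since `α = 2` has fractional part
  -- zero.
  have hfrac : θ + 1 - ⌊θ + 1⌋₊ = 1 / 2 → θ = 1 / 2 ∧ ⌊θ + 1⌋₊ = 1 := by
    intro h
    rcases h2.lt_or_eq with h2 | h2
    · rw [floor_eq_one h1 h2] at h ⊢
      exact ⟨by push_cast at h; linarith, rfl⟩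
    · rw [h2, floor_two] at h
      norm_num at h
  have hwt : θ + 1 - ⌊θ + 1⌋₊ = 1 / 2 →
      weightedSq T (iterWeakDeriv T ⌊θ + 1⌋₊ f) ≤ K2 * eLpNorm w 2 (timeMeasure T) ^ 2 := by
    intro h
    obtain ⟨rfl, hfl⟩ := hfrac h
    rw [hfl]
    exact (weightedSq_congr hg).trans_le (weightedSq_fracIntegral_half_le hT hw)
  refine ⟨⟨hmem.1, ?_, hmem.2, ?_, ?_⟩, ?_⟩
  · rcases h2.lt_or_eq with h2 | h2
    · rw [floor_eq_one h1 h2]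
      intro k hk
      obtain rfl : k = 0 := by omega
      exact hv0
    · rw [h2, floor_two]
      intro k hk
      interval_cases k
      · exact hv0
      · obtain rfl : θ = 1 := by linarith
        exact (vanishesAtZero_primitive hT hwi).congr hg
  · exact fun h => (hwt h).trans_lt (ENNReal.mul_lt_top hK2t.lt_top (ENNReal.pow_lt_top hw.2))
  · intro h
    rcases h2.lt_or_eq with h2 | h2
    · rw [floor_eq_one h1 h2] at h ⊢
      rw [Nat.cast_one, add_sub_cancel_right] at h
      exact (vanishesAtZero_fracIntegral_of_half_lt h hT hw).congr hg
    · rw [h2, floor_two] at h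
      norm_num at h
  · rw [hSubNorm, if_neg (floor_ne_zero_of_one_lt h1)]
    refine rpow_half_le_of_le_mul_sq ?_
    rw [hSubFracNormSq, ← add_assoc, add_mul]
    refine add_le_add hn ?_
    split_ifs with h
    · exact hwt h
    · exact zero_le

/-! ### Linearity and pointwise bounds for `J^α`, `α > 1` -/

lemma intervalIntegrable_fracIntegral_integrand {T α : ℝ} (hα : 1 < α) (hT : 0 < T) {g : ℝ → ℝ}
    (hg : Integrable g (timeMeasure T)) {t : ℝ} (ht : t ∈ Icc 0 T) :
    IntervalIntegrable (fun s => (t - s) ^ (α - 1) / Real.Gamma α * g s) volume 0 t := by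
  have hgi : IntervalIntegrable g volume 0 t :=
    (intervalIntegrable_of_integrable_timeMeasure hT hg).mono_set (by
      rw [uIcc_of_le hT.le, uIcc_of_le ht.1]; exact Icc_subset_Icc_right ht.2)
  refine hgi.continuousOn_mul (Continuous.continuousOn ?_)
  exact ((continuous_const.sub continuous_id).rpow_const fun _ => Or.inr (by linarith)).div_const _

lemma fracIntegral_add {T α : ℝ} (hα : 1 < α) (hT : 0 < T) {g h : ℝ → ℝ}
    (hg : Integrable g (timeMeasure T)) (hh : Integrable h (timeMeasure T)) {t : ℝ}
    (ht : t ∈ Icc 0 T) :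
    fracIntegral α (fun s => g s + h s) t = fracIntegral α g t + fracIntegral α h t := by
  simp only [fracIntegral]
  rw [← intervalIntegral.integral_add (intervalIntegrable_fracIntegral_integrand hα hT hg ht)
    (intervalIntegrable_fracIntegral_integrand hα hT hh ht)]
  simp only [mul_add]

lemma fracIntegral_sub {T α : ℝ} (hα : 1 < α) (hT : 0 < T) {g h : ℝ → ℝ}
    (hg : Integrable g (timeMeasure T)) (hh : Integrable h (timeMeasure T)) {t : ℝ}
    (ht : t ∈ Icc 0 T) :
    fracIntegral α (fun s => g s - h s) t = fracIntegral α g t - fracIntegral α h t := by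
  simp only [fracIntegral]
  rw [← intervalIntegral.integral_sub (intervalIntegrable_fracIntegral_integrand hα hT hg ht)
    (intervalIntegrable_fracIntegral_integrand hα hT hh ht)]
  simp only [mul_sub]

lemma fracIntegral_congr_ae {T : ℝ} (α : ℝ) {g h : ℝ → ℝ} (hgh : g =ᵐ[timeMeasure T] h) {t : ℝ}
    (ht : t ∈ Icc 0 T) : fracIntegral α g t = fracIntegral α h t := by
  refine intervalIntegral.integral_congr_ae ?_
  have h0 := (ae_restrict_iff' measurableSet_Ioo).1 hgh
  have h1 : ∀ᵐ s : ℝ, s ≠ T := by simp [ae_iff, measure_singleton]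
  filter_upwards [h0, h1] with s hs hsT hst
  rw [uIoc_of_le ht.1] at hst
  rw [hs ⟨hst.1, lt_of_le_of_ne (hst.2.trans ht.2) hsT⟩]

/-- A pointwise bound of the integrand carries over to `J^α`, at the cost of the maximum
`T^{α-1}/Γ(α)` of the kernel. -/
lemma abs_fracIntegral_le {T α : ℝ} (hα : 1 < α) {g B : ℝ → ℝ} {t : ℝ} (ht : t ∈ Icc 0 T)
    (hB : IntervalIntegrable B volume 0 t) (hgB : ∀ᵐ s ∂timeMeasure T, s < t → |g s| ≤ B s) :
    |fracIntegral α g t| ≤ T ^ (α - 1) / Real.Gamma α * ∫ s in (0 : ℝ)..t, B s := by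
  have hΓ : 0 < Real.Gamma α := Real.Gamma_pos_of_pos (by linarith)
  rw [← intervalIntegral.integral_const_mul, fracIntegral, ← Real.norm_eq_abs]
  refine intervalIntegral.norm_integral_le_of_norm_le ht.1 ?_ (hB.const_mul _)
  have h0 := (ae_restrict_iff' measurableSet_Ioo).1 hgB
  have h1 : ∀ᵐ s : ℝ, s ≠ t := by simp [ae_iff, measure_singleton]
  filter_upwards [h0, h1] with s hs hst hsm
  have hlt : s < t := lt_of_le_of_ne hsm.2 hst
  rw [norm_mul, Real.norm_eq_abs, Real.norm_eq_abs,
    abs_of_nonneg (div_nonneg (Real.rpow_nonneg (by linarith) _) hΓ.le)]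
  have hBs := hs ⟨hsm.1, hlt.trans_le ht.2⟩ hlt
  have : (t - s) ^ (α - 1) ≤ T ^ (α - 1) :=
    Real.rpow_le_rpow (by linarith) (by linarith [hsm.1, ht.2]) (by linarith)
  have hT0 : 0 ≤ T := ht.1.trans ht.2
  gcongr

/-- `J^α : L²(0,T) → C[0,T]` is bounded for `α > 1`. -/
lemma exists_abs_fracIntegral_le_eLpNorm {T α : ℝ} (hα : 1 < α) (hT : 0 < T) :
    ∃ κ : ℝ, 0 ≤ κ ∧ ∀ g : ℝ → ℝ, MemLp g 2 (timeMeasure T) → ∀ t ∈ Icc 0 T,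
      |fracIntegral α g t| ≤ κ * (eLpNorm g 2 (timeMeasure T)).toReal := by
  have hΓ : 0 < Real.Gamma α := Real.Gamma_pos_of_pos (by linarith)
  have hfin : IsFiniteMeasure (timeMeasure T) := by unfold timeMeasure; infer_instance
  set c := ((timeMeasure T) univ ^ (1 / (1 : ℝ≥0∞).toReal - 1 / (2 : ℝ≥0∞).toReal)) with hc
  have hct : c ≠ ⊤ := ENNReal.rpow_ne_top_of_nonneg (by norm_num) (measure_ne_top _ _)
  refine ⟨T ^ (α - 1) / Real.Gamma α * c.toReal, by positivity, fun g hg t ht => ?_⟩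
  have hgi := integrable_of_memLp_two hg
  have hint : IntervalIntegrable (fun s => |g s|) volume 0 t :=
    (intervalIntegrable_of_integrable_timeMeasure hT hgi.abs).mono_set (by
      rw [uIcc_of_le hT.le, uIcc_of_le ht.1]; exact Icc_subset_Icc_right ht.2)
  refine (abs_fracIntegral_le hα ht hint (Filter.Eventually.of_forall fun s _ => le_rfl)).trans ?_
  rw [mul_assoc]
  gcongr
  have h1 : ∫ s in (0 : ℝ)..t, |g s| ≤ ∫ s, |g s| ∂timeMeasure T := by
    rw [intervalIntegral.integral_of_le ht.1, integral_Ioc_eq_integral_Ioo]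
    exact setIntegral_mono_set hgi.abs (Filter.Eventually.of_forall fun s => abs_nonneg _)
      (Ioo_subset_Ioo_right ht.2).eventuallyLE
  have h2 : ∫ s, |g s| ∂timeMeasure T = (eLpNorm g 1 (timeMeasure T)).toReal := by
    rw [eLpNorm_one_eq_lintegral_enorm, ← integral_norm_eq_lintegral_enorm hg.1]
    rfl
  rw [h2] at h1
  refine h1.trans ?_
  rw [mul_comm, ← ENNReal.toReal_mul]
  exact ENNReal.toReal_mono (ENNReal.mul_ne_top hg.2.ne hct)
    (eLpNorm_le_eLpNorm_mul_rpow_measure_univ one_le_two hg.1)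

/-! ### The linear Volterra equation -/

lemma memLp_mulVec {T : ℝ} {N : ℕ} {P : ℝ → Matrix (Fin N) (Fin N) ℝ}
    (hP : ∀ i j, MemLp (fun t => P t i j) ∞ (timeMeasure T)) {v : ℝ → Fin N → ℝ}
    (hv : ∀ j, MemLp (fun t => v t j) 2 (timeMeasure T)) (i : Fin N) :
    MemLp (fun t => (P t).mulVec (v t) i) 2 (timeMeasure T) := by
  have : ∀ j ∈ (Finset.univ : Finset (Fin N)),
      MemLp (fun t => P t i j * v t j) 2 (timeMeasure T) := fun j _ => (hv j).mul (hP i j)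
  exact memLp_finsetSum _ this

lemma memLp_of_continuousOn {T : ℝ} {f : ℝ → ℝ} (hf : ContinuousOn f (Icc 0 T)) :
    MemLp f 2 (timeMeasure T) := by
  have hfin : IsFiniteMeasure (timeMeasure T) := by unfold timeMeasure; infer_instance
  obtain ⟨C, hC⟩ := isCompact_Icc.exists_bound_of_continuousOn hf
  refine MemLp.of_bound ((hf.mono Ioo_subset_Icc_self).aestronglyMeasurable measurableSet_Ioo) C ?_
  exact (ae_restrict_iff' measurableSet_Ioo).2
    (Filter.Eventually.of_forall fun t ht => hC t ⟨ht.1.le, ht.2.le⟩)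

/-- The exponential weight rate for which the Volterra operator with a coefficient of size `m`
has norm at most `1/2`. -/
noncomputable def volterraRate (T α : ℝ) (N : ℕ) (m : ℝ) : ℝ :=
  2 * (T ^ (α - 1) / Real.Gamma α) * (N * m) + 1

lemma volterraRate_pos {T α m : ℝ} (hα : 1 < α) (hT : 0 < T) (N : ℕ) (hm : 0 ≤ m) :
    0 < volterraRate T α N m := by
  have hΓ : 0 < Real.Gamma α := Real.Gamma_pos_of_pos (by linarith)
  unfold volterraRate
  positivity

lemma abs_mulVec_le {N : ℕ} {A : Matrix (Fin N) (Fin N) ℝ} {m M : ℝ} (hm : 0 ≤ m)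
    (hA : ∀ i j, |A i j| ≤ m) {x : Fin N → ℝ} (hx : ∀ j, |x j| ≤ M) (i : Fin N) :
    |A.mulVec x i| ≤ N * m * M := by
  calc |A.mulVec x i| ≤ ∑ j, |A i j * x j| :=
        Finset.abs_sum_le_sum_abs (fun j => A i j * x j) Finset.univ
    _ ≤ ∑ _j : Fin N, m * M := by
        refine Finset.sum_le_sum fun j _ => ?_
        rw [abs_mul]
        exact mul_le_mul (hA i j) (hx j) (abs_nonneg _) hm
    _ = N * m * M := by simp [mul_assoc]

/-- The Volterra operator `v ↦ J^α (P v)` halves the norm with weight `e^{-λt}`. -/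
lemma abs_fracIntegral_mulVec_le {T α m : ℝ} (hα : 1 < α) (hT : 0 < T) {N : ℕ} (hm : 0 ≤ m)
    {P : ℝ → Matrix (Fin N) (Fin N) ℝ} (hP : ∀ i j, ∀ᵐ t ∂timeMeasure T, |P t i j| ≤ m)
    {v : ℝ → Fin N → ℝ} {M t : ℝ} (hM : 0 ≤ M) (ht : t ∈ Icc 0 T)
    (hv : ∀ s ∈ Icc 0 T, ∀ j, |v s j| ≤ M * Real.exp (volterraRate T α N m * s)) (i : Fin N) :
    |fracIntegral α (fun s => (P s).mulVec (v s) i) t|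
      ≤ 1 / 2 * M * Real.exp (volterraRate T α N m * t) := by
  have hr := volterraRate_pos hα hT N hm
  set r := volterraRate T α N m with hrdef
  have hΓ : 0 < Real.Gamma α := Real.Gamma_pos_of_pos (by linarith)
  set c := T ^ (α - 1) / Real.Gamma α with hc
  have hc0 : 0 ≤ c := by positivity
  have hall : ∀ᵐ s ∂timeMeasure T, ∀ i j, |P s i j| ≤ m :=
    ae_all_iff.2 fun i => ae_all_iff.2 fun j => hP i j
  have h := abs_fracIntegral_le hα ht
    (g := fun s => (P s).mulVec (v s) i) (B := fun s => N * m * (M * Real.exp (r * s)))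
    (by apply Continuous.intervalIntegrable; fun_prop) (by
      filter_upwards [hall, ae_restrict_mem measurableSet_Ioo] with s hs hsm _
      exact abs_mulVec_le hm hs (hv s ⟨hsm.1.le, hsm.2.le⟩) i)
  refine h.trans ?_
  have hint : ∫ s in (0 : ℝ)..t, N * m * (M * Real.exp (r * s))
      = N * m * M * ((Real.exp (r * t) - 1) / r) := by
    simp only [← mul_assoc]
    rw [intervalIntegral.integral_const_mul,
      intervalIntegral.integral_comp_mul_left (fun x => Real.exp x) hr.ne', integral_exp]
    simp only [mul_zero, Real.exp_zero, smul_eq_mul]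
    field_simp
  rw [hint, ← hc]
  have hE := Real.exp_pos (r * t)
  have h2 : c * (N * m) ≤ 1 / 2 * r := by rw [hrdef, volterraRate, ← hc]; linarith
  calc c * (N * m * M * ((Real.exp (r * t) - 1) / r))
      = c * (N * m) / r * (M * (Real.exp (r * t) - 1)) := by ring
    _ ≤ 1 / 2 * (M * Real.exp (r * t)) := by
        refine mul_le_mul ?_ ?_ ?_ (by norm_num)
        · rw [div_le_iff₀ hr]; exact h2
        · gcongr; linarith
        · refine mul_nonneg hM (sub_nonneg.2 (Real.one_le_exp (mul_nonneg hr.le ht.1)))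
    _ = 1 / 2 * M * Real.exp (r * t) := by ring

/-- A priori bound for continuous solutions of `v = b + J^α (P v)`. -/
lemma abs_le_of_volterra {T α m : ℝ} (hα : 1 < α) (hT : 0 < T) {N : ℕ} (hm : 0 ≤ m)
    {P : ℝ → Matrix (Fin N) (Fin N) ℝ} (hP : ∀ i j, ∀ᵐ t ∂timeMeasure T, |P t i j| ≤ m)
    {v b : ℝ → Fin N → ℝ} (hvc : ContinuousOn v (Icc 0 T)) {β : ℝ} (hβ : 0 ≤ β)
    (hb : ∀ t ∈ Icc 0 T, ∀ i, |b t i| ≤ β)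
    (hv : ∀ t ∈ Icc 0 T, ∀ i, v t i = b t i + fracIntegral α (fun s => (P s).mulVec (v s) i) t)
    {t : ℝ} (ht : t ∈ Icc 0 T) (i : Fin N) :
    |v t i| ≤ 2 * Real.exp (volterraRate T α N m * T) * β := by
  have hr := volterraRate_pos hα hT N hm
  set r := volterraRate T α N m with hrdef
  -- The maximum of the weighted norm is attained at some `t₀`.
  obtain ⟨t₀, ht₀, hmax⟩ := isCompact_Icc.exists_isMaxOn (nonempty_Icc.2 hT.le)
    (f := fun t => Real.exp (-(r * t)) * ‖v t‖)
    ((Continuous.continuousOn (by fun_prop)).mul hvc.norm)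
  set M := Real.exp (-(r * t₀)) * ‖v t₀‖ with hMdef
  have hM0 : 0 ≤ M := by positivity
  have hbound : ∀ s ∈ Icc 0 T, ∀ j, |v s j| ≤ M * Real.exp (r * s) := by
    intro s hs j
    have h1 : Real.exp (-(r * s)) * ‖v s‖ ≤ M := hmax hs
    rw [Real.exp_neg, inv_mul_le_iff₀ (Real.exp_pos _)] at h1
    have h2 : |v s j| ≤ ‖v s‖ := norm_le_pi_norm (v s) j
    linarith
  have hhalf : M ≤ β + 1 / 2 * M := by
    rw [hMdef, Real.exp_neg, inv_mul_le_iff₀ (Real.exp_pos _), ← Real.exp_neg, ← hMdef,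
      pi_norm_le_iff_of_nonneg (by positivity)]
    intro j
    rw [Real.norm_eq_abs, hv t₀ ht₀ j]
    refine (abs_add_le _ _).trans ?_
    have h1 := hb t₀ ht₀ j
    have h2 := abs_fracIntegral_mulVec_le hα hT hm hP hM0 ht₀ hbound j
    have h3 : β ≤ Real.exp (r * t₀) * β :=
      le_mul_of_one_le_left hβ (Real.one_le_exp (mul_nonneg hr.le ht₀.1))
    linarith
  have hM : M ≤ 2 * β := by linarith
  calc |v t i| ≤ M * Real.exp (r * t) := hbound t ht i
    _ ≤ 2 * β * Real.exp (r * T) := by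
        have : r * t ≤ r * T := mul_le_mul_of_nonneg_left ht.2 hr.le
        gcongr
    _ = _ := by ring

/-- Continuous solutions of `v = b + J^α (P v)` are unique. -/
lemma eqOn_of_volterra {T α : ℝ} (hα : 1 < α) (hT : 0 < T) {N : ℕ} {m : ℝ} (hm : 0 ≤ m)
    {P : ℝ → Matrix (Fin N) (Fin N) ℝ} (hPm : ∀ i j, MemLp (fun t => P t i j) ∞ (timeMeasure T))
    (hP : ∀ i j, ∀ᵐ t ∂timeMeasure T, |P t i j| ≤ m)
    {v v' b : ℝ → Fin N → ℝ} (hvc : ContinuousOn v (Icc 0 T)) (hvc' : ContinuousOn v' (Icc 0 T))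
    (hv : ∀ t ∈ Icc 0 T, ∀ i, v t i = b t i + fracIntegral α (fun s => (P s).mulVec (v s) i) t)
    (hv' : ∀ t ∈ Icc 0 T, ∀ i,
      v' t i = b t i + fracIntegral α (fun s => (P s).mulVec (v' s) i) t) :
    EqOn v v' (Icc 0 T) := by
  have hL : ∀ {x : ℝ → Fin N → ℝ}, ContinuousOn x (Icc 0 T) → ∀ i,
      Integrable (fun s => (P s).mulVec (x s) i) (timeMeasure T) := fun hx i =>
    integrable_of_memLp_two (memLp_mulVec hPm
      (fun j => memLp_of_continuousOn ((continuousOn_pi.1 hx) j)) i)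
  intro t ht
  ext i
  have h := abs_le_of_volterra hα hT hm hP (v := fun t => v t - v' t) (b := 0) (hvc.sub hvc')
    le_rfl (fun t _ i => by simp) (fun t ht i => by
      simp only [Pi.sub_apply, Pi.zero_apply, zero_add, Matrix.mulVec_sub]
      rw [fracIntegral_sub hα hT (hL hvc i) (hL hvc' i) ht, hv t ht i, hv' t ht i]
      ring) ht i
  rw [mul_zero] at h
  exact sub_eq_zero.1 (abs_eq_zero.1 (le_antisymm h (abs_nonneg _)))

/-- Continuous solutions of `v = b + J^α (P v)` exist, by the contraction principle for the weighted
functions `e^{-λt} v(t)`. -/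
lemma exists_volterra {T α : ℝ} (hα : 1 < α) (hT : 0 < T) {N : ℕ} {m : ℝ} (hm : 0 ≤ m)
    {P : ℝ → Matrix (Fin N) (Fin N) ℝ} (hPm : ∀ i j, MemLp (fun t => P t i j) ∞ (timeMeasure T))
    (hP : ∀ i j, ∀ᵐ t ∂timeMeasure T, |P t i j| ≤ m)
    {b : ℝ → Fin N → ℝ} (hb : ContinuousOn b (Icc 0 T)) :
    ∃ v : ℝ → Fin N → ℝ, ContinuousOn v (Icc 0 T) ∧ ∀ t ∈ Icc 0 T, ∀ i,
      v t i = b t i + fracIntegral α (fun s => (P s).mulVec (v s) i) t := by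
  set r := volterraRate T α N m with hrdef
  -- `E y` is the function on the line with weighted values `y`.
  let E : C(Icc (0 : ℝ) T, Fin N → ℝ) → ℝ → Fin N → ℝ :=
    fun y s => Real.exp (r * s) • y (projIcc 0 T hT.le s)
  have hEc : ∀ y, Continuous (E y) := fun y =>
    (show Continuous fun s : ℝ => Real.exp (r * s) by fun_prop).smul
      (y.continuous.comp continuous_projIcc)
  have hEi : ∀ y i, Integrable (fun s => (P s).mulVec (E y s) i) (timeMeasure T) := fun y i =>
    integrable_of_memLp_two (memLp_mulVec hPm
      (fun j => memLp_of_continuousOn ((continuous_pi_iff.1 (hEc y)) j).continuousOn) i)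
  have hJc : ∀ y i, ContinuousOn (fracIntegral α fun s => (P s).mulVec (E y s) i) (Icc 0 T) := by
    intro y i
    have := continuousOn_fracIntegral_add_one (θ := α - 1) (by linarith) hT (hEi y i)
    rwa [sub_add_cancel] at this
  let Φ : C(Icc (0 : ℝ) T, Fin N → ℝ) → C(Icc (0 : ℝ) T, Fin N → ℝ) := fun y =>
    ⟨fun t i => Real.exp (-(r * t)) * (b t i + fracIntegral α (fun s => (P s).mulVec (E y s) i) t),
      continuous_pi fun i => (show Continuous fun t : Icc (0 : ℝ) T => Real.exp (-(r * t)) by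
        fun_prop).mul (((continuousOn_pi.1 hb i).domRestrict).add (hJc y i).domRestrict)⟩
  have hΦ : ContractingWith (1 / 2) Φ := by
    refine ⟨by norm_num, LipschitzWith.of_dist_le_mul fun y z => ?_⟩
    rw [ContinuousMap.dist_le (by positivity)]
    intro t
    rw [dist_pi_le_iff (by positivity)]
    intro i
    have hsub : ∀ s, E (y - z) s = E y s - E z s := fun s => by simp [E, smul_sub]
    have hest := abs_fracIntegral_mulVec_le hα hT hm hP (v := E (y - z)) (M := dist y z) dist_nonneg
      t.2 (fun s _ j => by
        have h1 : |(y - z) (projIcc 0 T hT.le s) j| ≤ dist y z := by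
          rw [dist_eq_norm]
          exact (norm_le_pi_norm _ j).trans ((y - z).norm_coe_le_norm _)
        simp only [E, Pi.smul_apply, smul_eq_mul]
        rw [abs_mul, Real.abs_exp, mul_comm]
        gcongr) i
    simp only [hsub, Matrix.mulVec_sub, Pi.sub_apply] at hest
    rw [fracIntegral_sub hα hT (hEi y i) (hEi z i) t.2] at hest
    simp only [Φ, ContinuousMap.coe_mk, Real.dist_eq]
    rw [← mul_sub, add_sub_add_left_eq_sub, abs_mul, Real.abs_exp, Real.exp_neg,
      inv_mul_le_iff₀ (Real.exp_pos _)]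
    refine hest.trans (le_of_eq ?_)
    push_cast
    ring
  set y := ContractingWith.fixedPoint Φ hΦ
  have hy : Φ y = y := hΦ.fixedPoint_isFixedPt
  refine ⟨E y, (hEc y).continuousOn, fun t ht i => ?_⟩
  have h1 : y (projIcc 0 T hT.le t) i = Real.exp (-(r * t)) *
      (b t i + fracIntegral α (fun s => (P s).mulVec (E y s) i) t) := by
    conv_lhs => rw [← hy]
    simp only [Φ, ContinuousMap.coe_mk]
    rw [projIcc_of_mem hT.le ht]
  change Real.exp (r * t) * y (projIcc 0 T hT.le t) i = _
  rw [h1, ← mul_assoc, ← Real.exp_add, add_neg_cancel, Real.exp_zero, one_mul]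

/-! ### The initial value problem -/

lemma memLp_apply {T : ℝ} {N : ℕ} {F : ℝ → EuclideanSpace ℝ (Fin N)}
    (hF : MemLp F 2 (timeMeasure T)) (i : Fin N) : MemLp (fun t => F t i) 2 (timeMeasure T) :=
  hF.of_le ((PiLp.continuous_apply 2 _ i).comp_aestronglyMeasurable hF.1)
    (Filter.Eventually.of_forall fun t => PiLp.norm_apply_le (F t) i)

lemma eLpNorm_apply_le (T : ℝ) {N : ℕ} (F : ℝ → EuclideanSpace ℝ (Fin N)) (i : Fin N) :
    eLpNorm (fun t => F t i) 2 (timeMeasure T) ≤ eLpNorm F 2 (timeMeasure T) :=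
  eLpNorm_mono fun t => PiLp.norm_apply_le (F t) i

lemma ae_abs_le_linftyNorm {T : ℝ} {N : ℕ} {P : ℝ → Matrix (Fin N) (Fin N) ℝ}
    (hP : ∀ i j, MemLp (fun t => P t i j) ∞ (timeMeasure T)) (i j : Fin N) :
    ∀ᵐ t ∂timeMeasure T, |P t i j| ≤ linftyNorm T P := by
  set S := ⨆ i, ⨆ j, eLpNorm (fun t => P t i j) ∞ (timeMeasure T) with hS
  have hSt : S ≠ ⊤ := by
    refine ne_top_of_le_ne_top (b := ∑ i, ∑ j, eLpNorm (fun t => P t i j) ∞ (timeMeasure T))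
      (ENNReal.sum_ne_top.2 fun i _ => ENNReal.sum_ne_top.2 fun j _ => (hP i j).2.ne) ?_
    refine iSup_le fun i => iSup_le fun j => ?_
    exact (Finset.single_le_sum (f := fun j => eLpNorm (fun t => P t i j) ∞ (timeMeasure T))
      (fun _ _ => zero_le) (Finset.mem_univ j)).trans
      (Finset.single_le_sum (f := fun i => ∑ j, eLpNorm (fun t => P t i j) ∞ (timeMeasure T))
        (fun _ _ => zero_le) (Finset.mem_univ i))
  filter_upwards [ae_le_eLpNormEssSup (f := fun t => P t i j) (μ := timeMeasure T)] with t ht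
  have h1 : ‖P t i j‖ₑ ≤ S := by
    refine ht.trans ?_
    rw [← eLpNorm_exponent_top]
    exact (le_iSup (fun j => eLpNorm (fun t => P t i j) ∞ (timeMeasure T)) j).trans
      (le_iSup (fun i => ⨆ j, eLpNorm (fun t => P t i j) ∞ (timeMeasure T)) i)
  have h2 := ENNReal.toReal_mono hSt h1
  rwa [toReal_enorm] at h2

/-- The `ℓ²` combination of finitely many norms is at most their sum. -/
lemma sum_sq_rpow_half_le {ι : Type*} (s : Finset ι) (f : ι → ℝ≥0∞) :
    (∑ i ∈ s, f i ^ 2) ^ (1 / 2 : ℝ) ≤ ∑ i ∈ s, f i := by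
  have h : ∑ i ∈ s, f i ^ 2 ≤ (∑ i ∈ s, f i) ^ 2 := by
    rw [sq (∑ i ∈ s, f i), Finset.sum_mul]
    refine Finset.sum_le_sum fun i hi => ?_
    rw [sq]
    exact mul_le_mul_right (Finset.single_le_sum (fun _ _ => zero_le) hi) _
  refine (ENNReal.rpow_le_rpow h (by norm_num)).trans (le_of_eq ?_)
  rw [← ENNReal.rpow_natCast, ← ENNReal.rpow_mul]
  norm_num

/-- The inhomogeneity `a₀ + t a₁ + J^α F` of the Volterra equation that is equivalent to the
initial value problem. -/
noncomputable def volterraData (α : ℝ) {N : ℕ} (a₀ a₁ : EuclideanSpace ℝ (Fin N))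
    (F : ℝ → EuclideanSpace ℝ (Fin N)) (t : ℝ) (i : Fin N) : ℝ :=
  a₀ i + t * a₁ i + fracIntegral α (fun s => F s i) t

lemma continuousOn_fracIntegral {T α : ℝ} (hα : 1 < α) (hT : 0 < T) {w : ℝ → ℝ}
    (hw : Integrable w (timeMeasure T)) : ContinuousOn (fracIntegral α w) (Icc 0 T) := by
  have := continuousOn_fracIntegral_add_one (θ := α - 1) (by linarith) hT hw
  rwa [sub_add_cancel] at this

lemma continuousOn_volterraData {T α : ℝ} (hα : 1 < α) (hT : 0 < T) {N : ℕ}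
    (a₀ a₁ : EuclideanSpace ℝ (Fin N)) {F : ℝ → EuclideanSpace ℝ (Fin N)}
    (hF : MemLp F 2 (timeMeasure T)) : ContinuousOn (volterraData α a₀ a₁ F) (Icc 0 T) := by
  refine continuousOn_pi.2 fun i => ContinuousOn.add (Continuous.continuousOn (by fun_prop)) ?_
  exact continuousOn_fracIntegral hα hT (integrable_of_memLp_two (memLp_apply hF i))

/-- A continuous solution of the Volterra equation solves the initial value problem. -/
lemma isSolution_of_volterra {T α : ℝ} (h1 : 1 < α) (h2 : α ≤ 2) (hT : 0 < T) {N : ℕ}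
    {a₀ a₁ : EuclideanSpace ℝ (Fin N)} {F : ℝ → EuclideanSpace ℝ (Fin N)}
    {P : ℝ → Matrix (Fin N) (Fin N) ℝ} (hF : MemLp F 2 (timeMeasure T))
    (hP : ∀ i j, MemLp (fun t => P t i j) ∞ (timeMeasure T)) {v : ℝ → Fin N → ℝ}
    (hvc : ContinuousOn v (Icc 0 T))
    (hv : ∀ t ∈ Icc 0 T, ∀ i, v t i
      = volterraData α a₀ a₁ F t i + fracIntegral α (fun s => (P s).mulVec (v s) i) t) :
    (∀ i, MemLp (fun t => (P t).mulVec (v t) i + F t i) 2 (timeMeasure T)) ∧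
    (∀ t ∈ Icc 0 T, ∀ i, v t i
      = a₀ i + a₁ i * t + fracIntegral α (fun s => (P s).mulVec (v s) i + F s i) t) ∧
    IsSolution T α a₀ a₁ P F fun t => WithLp.toLp 2 (v t) := by
  have hPv : ∀ i, MemLp (fun t => (P t).mulVec (v t) i) 2 (timeMeasure T) :=
    memLp_mulVec hP fun j => memLp_of_continuousOn ((continuousOn_pi.1 hvc) j)
  have hw : ∀ i, MemLp (fun t => (P t).mulVec (v t) i + F t i) 2 (timeMeasure T) :=
    fun i => (hPv i).add (memLp_apply hF i)
  have heq : ∀ t ∈ Icc 0 T, ∀ i, v t i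
      = a₀ i + a₁ i * t + fracIntegral α (fun s => (P s).mulVec (v s) i + F s i) t := by
    intro t ht i
    rw [fracIntegral_add h1 hT (integrable_of_memLp_two (hPv i))
      (integrable_of_memLp_two (memLp_apply hF i)) ht, hv t ht i, volterraData]
    ring
  obtain ⟨K, -, hK⟩ := exists_memHSub_and_hSubNorm_le h1 h2 hT
  refine ⟨hw, heq, fun i => ?_⟩
  have hae : (fun t => (WithLp.toLp 2 (v t) - a₀ - t • a₁) i) =ᵐ[timeMeasure T]
      fracIntegral α fun s => (P s).mulVec (v s) i + F s i := by
    filter_upwards [ae_restrict_mem measurableSet_Ioo] with t ht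
    simp only [PiLp.sub_apply, PiLp.smul_apply, smul_eq_mul]
    rw [heq t ⟨ht.1.le, ht.2.le⟩ i]
    ring
  have hmem := (hK _ _ (hw i) hae).1
  exact ⟨hmem, hmem, hw i, hae.symm⟩

/-- A solution of the initial value problem has a continuous representative that solves the
Volterra equation. -/
lemma IsSolution.exists_volterra {T α : ℝ} (h1 : 1 < α) (hT : 0 < T) {N : ℕ}
    {a₀ a₁ : EuclideanSpace ℝ (Fin N)} {F x : ℝ → EuclideanSpace ℝ (Fin N)}
    {P : ℝ → Matrix (Fin N) (Fin N) ℝ} (hF : MemLp F 2 (timeMeasure T))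
    (hP : ∀ i j, MemLp (fun t => P t i j) ∞ (timeMeasure T))
    (hx : IsSolution T α a₀ a₁ P F x) :
    ∃ v : ℝ → Fin N → ℝ, ContinuousOn v (Icc 0 T) ∧
      (∀ t ∈ Icc 0 T, ∀ i, v t i
        = volterraData α a₀ a₁ F t i + fracIntegral α (fun s => (P s).mulVec (v s) i) t) ∧
      x =ᵐ[timeMeasure T] fun t => WithLp.toLp 2 (v t) := by
  set g : Fin N → ℝ → ℝ := fun i t => (P t).mulVec (x t).ofLp i + F t i with hg
  have hgm : ∀ i, MemLp (g i) 2 (timeMeasure T) := fun i => (hx i).2.2.1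
  -- The right-hand side built from `x` itself gives the continuous representative; replacing `x` by
  -- `v` under the integral does not change it.
  set v : ℝ → Fin N → ℝ := fun t i => a₀ i + t * a₁ i + fracIntegral α (g i) t with hvdef
  have hvc : ContinuousOn v (Icc 0 T) :=
    continuousOn_pi.2 fun i => ContinuousOn.add (Continuous.continuousOn (by fun_prop))
      (continuousOn_fracIntegral h1 hT (integrable_of_memLp_two (hgm i)))
  have hxv : ∀ᵐ t ∂timeMeasure T, ∀ i, x t i = v t i := by
    refine ae_all_iff.2 fun i => ?_
    filter_upwards [(hx i).2.2.2] with t ht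
    simp only [PiLp.sub_apply, PiLp.smul_apply, smul_eq_mul] at ht
    simp only [hvdef, hg]
    linarith
  have hgv : ∀ i, g i =ᵐ[timeMeasure T] fun t => F t i + (P t).mulVec (v t) i := by
    intro i
    filter_upwards [hxv] with t ht
    have : (x t).ofLp = v t := funext ht
    simp only [hg]
    rw [this, add_comm]
  refine ⟨v, hvc, fun t ht i => ?_, ?_⟩
  · have hPv : MemLp (fun t => (P t).mulVec (v t) i) 2 (timeMeasure T) :=
      memLp_mulVec hP (fun j => memLp_of_continuousOn ((continuousOn_pi.1 hvc) j)) i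
    simp only [volterraData]
    rw [add_assoc, ← fracIntegral_add h1 hT (integrable_of_memLp_two (memLp_apply hF i))
      (integrable_of_memLp_two hPv) ht, ← fracIntegral_congr_ae α (hgv i) ht]
  · filter_upwards [hxv] with t ht
    ext i
    exact ht i

/-- The a priori estimate for the right-hand side `P u + F`. -/
lemma exists_eLpNorm_rhs_le {T α : ℝ} (h1 : 1 < α) (hT : 0 < T) (N : ℕ) (m : ℝ) (hm : 0 ≤ m) :
    ∃ Q : ℝ≥0∞, Q ≠ ⊤ ∧ ∀ (a₀ a₁ : EuclideanSpace ℝ (Fin N)) (F : ℝ → EuclideanSpace ℝ (Fin N))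
      (P : ℝ → Matrix (Fin N) (Fin N) ℝ) (v : ℝ → Fin N → ℝ), MemLp F 2 (timeMeasure T) →
      (∀ i j, MemLp (fun t => P t i j) ∞ (timeMeasure T)) →
      (∀ i j, ∀ᵐ t ∂timeMeasure T, |P t i j| ≤ m) → ContinuousOn v (Icc 0 T) →
      (∀ t ∈ Icc 0 T, ∀ i, v t i
        = volterraData α a₀ a₁ F t i + fracIntegral α (fun s => (P s).mulVec (v s) i) t) →
      ∀ i, eLpNorm (fun t => (P t).mulVec (v t) i + F t i) 2 (timeMeasure T)
        ≤ Q * (‖a₀‖ₑ + ‖a₁‖ₑ + eLpNorm F 2 (timeMeasure T)) := by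
  obtain ⟨κ, hκ, hκb⟩ := exists_abs_fracIntegral_le_eLpNorm h1 hT
  set k := 2 * Real.exp (volterraRate T α N m * T) * (1 + T + κ) with hk
  have hk0 : 0 ≤ k := by positivity
  set e1 := eLpNorm (fun _ => (1 : ℝ)) 2 (timeMeasure T) with he1
  refine ⟨ENNReal.ofReal (N * m * k) * e1 + 1, by
    have : e1 ≠ ⊤ := (memLp_const_timeMeasure T 1).2.ne
    finiteness, fun a₀ a₁ F P v hF hP hPm hvc hv i => ?_⟩
  set S := ‖a₀‖ₑ + ‖a₁‖ₑ + eLpNorm F 2 (timeMeasure T) with hS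
  have hSt : S ≠ ⊤ := by have := hF.2.ne; finiteness
  have hSr : S.toReal = ‖a₀‖ + ‖a₁‖ + (eLpNorm F 2 (timeMeasure T)).toReal := by
    rw [hS, ENNReal.toReal_add (by finiteness) hF.2.ne,
      ENNReal.toReal_add (by finiteness) (by finiteness), toReal_enorm, toReal_enorm]
  have hdata : ∀ t ∈ Icc 0 T, ∀ i, |volterraData α a₀ a₁ F t i| ≤ (1 + T + κ) * S.toReal := by
    intro t ht i
    have b0 : |a₀ i| ≤ ‖a₀‖ := PiLp.norm_apply_le a₀ i
    have b1 : |a₁ i| ≤ ‖a₁‖ := PiLp.norm_apply_le a₁ i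
    have bF := (hκb _ (memLp_apply hF i) t ht).trans (mul_le_mul_of_nonneg_left
      (ENNReal.toReal_mono hF.2.ne (eLpNorm_apply_le T F i)) hκ)
    set φ := (eLpNorm F 2 (timeMeasure T)).toReal
    have hφ : 0 ≤ φ := ENNReal.toReal_nonneg
    have bt : |t * a₁ i| ≤ T * ‖a₁‖ := by
      rw [abs_mul, abs_of_nonneg ht.1]
      exact mul_le_mul ht.2 b1 (abs_nonneg _) hT.le
    have h3 := abs_add_three (a₀ i) (t * a₁ i) (fracIntegral α (fun s => F s i) t)
    rw [hSr, volterraData]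
    have : (1 + T + κ) * (‖a₀‖ + ‖a₁‖ + φ) = ‖a₀‖ + T * ‖a₁‖ + κ * φ
        + ((T + κ) * ‖a₀‖ + (1 + κ) * ‖a₁‖ + (1 + T) * φ) := by ring
    have : 0 ≤ (T + κ) * ‖a₀‖ + (1 + κ) * ‖a₁‖ + (1 + T) * φ := by positivity
    linarith
  have hvb : ∀ t ∈ Icc 0 T, ∀ j, |v t j| ≤ k * S.toReal := fun t ht j =>
    (abs_le_of_volterra h1 hT hm hPm hvc (by positivity) hdata hv ht j).trans
      (le_of_eq (by rw [hk]; ring))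
  have hPv : MemLp (fun t => (P t).mulVec (v t) i) 2 (timeMeasure T) :=
    memLp_mulVec hP (fun j => memLp_of_continuousOn ((continuousOn_pi.1 hvc) j)) i
  have hall : ∀ᵐ s ∂timeMeasure T, ∀ i j, |P s i j| ≤ m :=
    ae_all_iff.2 fun i => ae_all_iff.2 fun j => hPm i j
  have hPvn : eLpNorm (fun t => (P t).mulVec (v t) i) 2 (timeMeasure T)
      ≤ ENNReal.ofReal (N * m * k) * e1 * S := by
    have hle : eLpNorm (fun t => (P t).mulVec (v t) i) 2 (timeMeasure T)
        ≤ eLpNorm (fun _ => N * m * (k * S.toReal)) 2 (timeMeasure T) := by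
      refine eLpNorm_mono_ae ?_
      filter_upwards [hall, ae_restrict_mem measurableSet_Ioo] with s hs hsm
      rw [Real.norm_eq_abs, Real.norm_of_nonneg (by positivity)]
      exact abs_mulVec_le hm hs (hvb s ⟨hsm.1.le, hsm.2.le⟩) i
    refine hle.trans (le_of_eq ?_)
    rw [eLpNorm_const_timeMeasure, Real.enorm_of_nonneg (by positivity), ← mul_assoc (N * m : ℝ),
      ENNReal.ofReal_mul (by positivity), ENNReal.ofReal_toReal hSt, mul_right_comm]
  rw [add_mul, one_mul]
  refine (eLpNorm_add_le hPv.1 (memLp_apply hF i).1 one_le_two).trans (add_le_add hPvn ?_)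
  exact (eLpNorm_apply_le T F i).trans le_add_self

/-- The norm estimate for solutions, with a constant depending on the coefficient only through its
bound `m`. -/
lemma exists_norm_bound_of_volterra {T α : ℝ} (h1 : 1 < α) (h2 : α ≤ 2) (hT : 0 < T) (N : ℕ)
    (m : ℝ) (hm : 0 ≤ m) :
    ∃ C : ℝ, 0 < C ∧ ∀ (a₀ a₁ : EuclideanSpace ℝ (Fin N)) (F : ℝ → EuclideanSpace ℝ (Fin N))
      (P : ℝ → Matrix (Fin N) (Fin N) ℝ) (v : ℝ → Fin N → ℝ), MemLp F 2 (timeMeasure T) →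
      (∀ i j, MemLp (fun t => P t i j) ∞ (timeMeasure T)) →
      (∀ i j, ∀ᵐ t ∂timeMeasure T, |P t i j| ≤ m) → ContinuousOn v (Icc 0 T) →
      (∀ t ∈ Icc 0 T, ∀ i, v t i
        = volterraData α a₀ a₁ F t i + fracIntegral α (fun s => (P s).mulVec (v s) i) t) →
      (∀ i, MemH T α fun t => v t i) ∧
      hSubNormVec T α (fun t => WithLp.toLp 2 (v t) - a₀ - t • a₁)
          + hNormVec T α (fun t => WithLp.toLp 2 (v t))
        ≤ ENNReal.ofReal C * (‖a₀‖ₑ + ‖a₁‖ₑ + eLpNorm F 2 (timeMeasure T)) := by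
  obtain ⟨Q, hQ, hQb⟩ := exists_eLpNorm_rhs_le h1 hT N m hm
  obtain ⟨K1, hK1, hb1⟩ := exists_memHSub_and_hSubNorm_le h1 h2 hT
  obtain ⟨K2, hK2, hb2⟩ := exists_memH_and_hNorm_le h1 h2 hT
  set D := N * (K1 * Q) + N * (K2 * (1 + Q)) with hD
  have hDt : D ≠ ⊤ := by finiteness
  refine ⟨D.toReal + 1, by positivity, fun a₀ a₁ F P v hF hP hPm hvc hv => ?_⟩
  set S := ‖a₀‖ₑ + ‖a₁‖ₑ + eLpNorm F 2 (timeMeasure T) with hS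
  obtain ⟨hw, heq, hsol⟩ := isSolution_of_volterra h1 h2 hT hF hP hvc hv
  have hwb := hQb a₀ a₁ F P v hF hP hPm hvc hv
  have hae : ∀ i, (fun t => v t i) =ᵐ[timeMeasure T] fun t =>
      a₀ i + a₁ i * t + fracIntegral α (fun s => (P s).mulVec (v s) i + F s i) t := fun i => by
    filter_upwards [ae_restrict_mem measurableSet_Ioo] with t ht
    exact heq t ⟨ht.1.le, ht.2.le⟩ i
  refine ⟨fun i => (hb2 _ _ _ _ (hw i) (hae i)).1, ?_⟩
  have hsub : hSubNormVec T α (fun t => WithLp.toLp 2 (v t) - a₀ - t • a₁) ≤ N * (K1 * Q) * S := by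
    refine (sum_sq_rpow_half_le _ _).trans ?_
    refine (Finset.sum_le_sum (g := fun _ => K1 * (Q * S)) fun i _ => ?_).trans
      (le_of_eq (by simp [mul_assoc]))
    exact (hb1 _ _ (hw i) (hsol i).2.2.2.symm).2.trans (mul_le_mul_right (hwb i) _)
  have hfull : hNormVec T α (fun t => WithLp.toLp 2 (v t)) ≤ N * (K2 * (1 + Q)) * S := by
    refine (sum_sq_rpow_half_le _ _).trans ?_
    refine (Finset.sum_le_sum (g := fun _ => K2 * ((1 + Q) * S)) fun i _ => ?_).trans
      (le_of_eq (by simp [mul_assoc]))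
    refine (hb2 _ _ _ _ (hw i) (hae i)).2.trans (mul_le_mul_right ?_ _)
    rw [dataNorm, add_mul, one_mul]
    refine add_le_add ((add_le_add ?_ ?_).trans le_self_add) (hwb i)
    · exact enorm_le_iff_norm_le.2 (PiLp.norm_apply_le a₀ i)
    · exact enorm_le_iff_norm_le.2 (PiLp.norm_apply_le a₁ i)
  calc _ ≤ N * (K1 * Q) * S + N * (K2 * (1 + Q)) * S := add_le_add hsub hfull
    _ = D * S := by rw [hD, add_mul]
    _ ≤ ENNReal.ofReal (D.toReal + 1) * S := by
        gcongr
        rw [← ENNReal.ofReal_toReal hDt]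
        exact ENNReal.ofReal_le_ofReal (by rw [ENNReal.toReal_ofReal (by positivity)]; linarith)

end FracODE

theorem mainTheorem3 (N : ℕ) (T α : ℝ) (hT : 0 < T) (hα₁ : 1 < α) (hα₂ : α ≤ 2) :
    ∃ C : ℝ → ℝ, (∀ m, 0 < C m) ∧
      ∀ (a₀ a₁ : EuclideanSpace ℝ (Fin N)) (F : ℝ → EuclideanSpace ℝ (Fin N))
        (P : ℝ → Matrix (Fin N) (Fin N) ℝ),
        MemLp F 2 (FracODE.timeMeasure T) →
        (∀ i j, MemLp (fun t => P t i j) ∞ (FracODE.timeMeasure T)) →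
        ∃ u : ℝ → EuclideanSpace ℝ (Fin N),
          FracODE.IsSolution T α a₀ a₁ P F u ∧
          (∀ w : ℝ → EuclideanSpace ℝ (Fin N),
            FracODE.IsSolution T α a₀ a₁ P F w → w =ᵐ[FracODE.timeMeasure T] u) ∧
          (∀ i, FracODE.MemH T α (fun t => u t i)) ∧
          FracODE.hSubNormVec T α (fun t => u t - a₀ - t • a₁) + FracODE.hNormVec T α u ≤
            ENNReal.ofReal (C (FracODE.linftyNorm T P)) *
              (‖a₀‖ₑ + ‖a₁‖ₑ + eLpNorm F 2 (FracODE.timeMeasure T)) := by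
  -- The constant is needed for every real `m`, and norms are nonnegative: `|m|` extends the bound.
  choose C hC0 hC using fun m : ℝ =>
    FracODE.exists_norm_bound_of_volterra hα₁ hα₂ hT N |m| (abs_nonneg m)
  refine ⟨C, hC0, fun a₀ a₁ F P hF hP => ?_⟩
  have hm : 0 ≤ FracODE.linftyNorm T P := ENNReal.toReal_nonneg
  have hPm := FracODE.ae_abs_le_linftyNorm hP
  obtain ⟨v, hvc, hv⟩ := FracODE.exists_volterra hα₁ hT hm hP hPm
    (FracODE.continuousOn_volterraData hα₁ hT a₀ a₁ hF)
  obtain ⟨hmem, hbound⟩ := hC (FracODE.linftyNorm T P) a₀ a₁ F P v hF hP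
    (by rwa [abs_of_nonneg hm]) hvc hv
  refine ⟨fun t => WithLp.toLp 2 (v t),
    (FracODE.isSolution_of_volterra hα₁ hα₂ hT hF hP hvc hv).2.2, fun w hw => ?_, hmem, hbound⟩
  obtain ⟨v', hvc', hv', hwv'⟩ := hw.exists_volterra hα₁ hT hF hP
  have heq := FracODE.eqOn_of_volterra hα₁ hT hm hP hPm hvc' hvc hv' hv
  filter_upwards [hwv', ae_restrict_mem measurableSet_Ioo] with t ht htm
  rw [ht, heq ⟨htm.1.le, htm.2.le⟩]
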